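/- All manifolds are smooth, finite-dimensional, Hausdorff and second countable. A Lie groupoid $\mathbb{X}=[X_1\rightrightarrows X_0]$ is a groupoid whose objects and arrows form manifolds, with smooth structure maps, and whose source $s$ and target $t$ are surjective submersions; $\gamma_2\circ\gamma_1$ is defined when $s(\gamma_2)=t(\gamma_1)$. A Lie 2-group $\mathbb{G}=[G_1\rightrightarrows G_0]$ is a Lie groupoid in which $G_0,G_1$ are Lie groups and all structure maps are homomorphisms. Its crossed module consists of $G_0$, the Lie group $H=\ker(s\colon G_1\to G_0)$, the map $\tau=t|_H\colon H\to G_0$ and the action $\alpha_g(h)=1_g\,h\,1_{g^{-1}}$ of $G_0$ on $H$; one has $G_1= H\rtimes G_0$, where $(h,g)$ stands for $h\,1_g$. A principal $\mathbb{G}$-bundle (principal 2-bundle) over $\mathbb{X}$ is a Lie groupoid $\mathbb{E}=[E_1\rightrightarrows E_0]$ with a smooth functor $\pi=(\pi_0,\pi_1)\colon\mathbb{E}\to\mathbb{X}$ and a right action of $\mathbb{G}$ on $\mathbb{E}$, given by a functor $\mathbb{E}\times\mathbb{G}\to\mathbb{E}$, such that $\pi_i\colon E_i\to X_i$ is a (smooth,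 locally trivial) principal $G_i$-bundle for $i=0,1$. An isomorphism of principal $\mathbb{G}$-bundles over $\mathbb{X}$ is a pair of diffeomorphisms on objects and on arrows that form a functor, commute with the $\mathbb{G}$-actions and lie over the identity of $\mathbb{X}$. A principal $G_0$-bundle over $\mathbb{X}$ is a principal $G_0$-bundle $\pi\colon E\to X_0$ with a smooth left action $\mu\colon s^*E=X_1\times_{s,X_0,\pi}E\to E$ of $\mathbb{X}$, that is, $\pi(\mu(\gamma,p))=t(\gamma)$, $\mu(1_{\pi(p)},p)=p$ and $\mu(\gamma_2\circ\gamma_1,p)=\mu(\gamma_2,\mu(\gamma_1,p))$, such that $\mu(\gamma,p)g=\mu(\gamma,pg)$ for all $g\in G_0$. The decorated bundle associated to it is the principal $\mathbb{G}$-bundle $\mathbb{E}^{\rm dec}=[s^*E\times H\rightrightarrows E]$ over $\mathbb{X}$ in which $(\gamma,p,h)$ has source $p$, target $\mu(\gamma,p)\tau(h^{-1})$ and inverse $(\gamma^{-1},\mu(\gamma,p)\tau(h^{-1}),h^{-1})$, the unit at $p$ is $(1_{\pi(p)},p,e)$, the composition is $(\gamma_2,p_2,h_2)\circ(\gamma_1,p_1,h_1)=(\gamma_2\circ\gamma_1,p_1,h_2h_1)$,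 the projection is $p\mapsto\pi(p)$, $(\gamma,p,h)\mapsto\gamma$, and the action is the given one on objects and $(\gamma,p,h)(h',g)=(\gamma,pg,\alpha_{g^{-1}}(h'^{-1}h))$ on arrows. A categorical connection on a principal $\mathbb{G}$-bundle $\pi\colon\mathbb{E}\to\mathbb{X}$ is a smooth embedding $\mathcal{C}\colon s^*E_0=X_1\times_{s,X_0,\pi_0}E_0\to E_1$ such that 1. $s(\mathcal{C}(\gamma,p))=p$ and $\pi_1(\mathcal{C}(\gamma,p))=\gamma$ for all $(\gamma,p)\in s^*E_0$; 2. $\mathcal{C}(\gamma_2\circ\gamma_1,p_1)=\mathcal{C}(\gamma_2,p_2)\circ\mathcal{C}(\gamma_1,p_1)$ for all $(\gamma_2,p_2),(\gamma_1,p_1)\in s^*E_0$ with $s(\gamma_2)=t(\gamma_1)$ and $p_2=t(\mathcal{C}(\gamma_1,p_1))$; 3. $\mathcal{C}(1_x,p)=1_p$ for all $x\in X_0$ and $p\in\pi_0^{-1}(x)$; 4. $\mathcal{C}(\gamma,pg)=\mathcal{C}(\gamma,p)\,1_g$ for all $(\gamma,p)\in s^*E_0$ and $g\in G_0$. Given $\mathcal{C}$,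 the action $\mu(\gamma,p)=t(\mathcal{C}(\gamma,p))$ makes $E_0\to X_0$ a principal $G_0$-bundle over $\mathbb{X}$. **Theorem.** Let $\mathbb{G}$ be a Lie 2-group and $\mathbb{E}$ a principal $\mathbb{G}$-bundle over a Lie groupoid $\mathbb{X}$. (a) $\mathbb{E}$ is isomorphic, as a principal $\mathbb{G}$-bundle over $\mathbb{X}$, to the decorated bundle associated to some principal $G_0$-bundle over $\mathbb{X}$ if and only if $\mathbb{E}$ admits a categorical connection. (b) For every categorical connection $\mathcal{C}$ on $\mathbb{E}$, let $\mathbb{E}^{\rm dec}=[s^*E_0\times H\rightrightarrows E_0]$ be the decorated bundle associated to $E_0\to X_0$ with the action $\mu(\gamma,p)=t(\mathcal{C}(\gamma,p))$. Then the identity of $E_0$ together with $$\theta\colon s^*E_0\times H\to E_1,\qquad \theta\bigl((\gamma,p),h\bigr)=\mathcal{C}(\gamma,p)\,(h^{-1},e)$$ is an isomorphism of principal $\mathbb{G}$-bundles $\mathbb{E}^{\rm dec}\to\mathbb{E}$ over $\mathbb{X}$. -/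

import Mathlib

open scoped Manifold ContDiff
open Set Topology

universe u

set_option linter.unusedSectionVars false

noncomputable section

namespace FiberChart

variable {EM HM M EN HN N EP HP P F S : Type*}
  [NormedAddCommGroup EM] [NormedSpace ℝ EM] [TopologicalSpace HM]
  [TopologicalSpace M] [ChartedSpace HM M] {I : ModelWithCorners ℝ EM HM} [I.Boundaryless]
  [NormedAddCommGroup EN] [NormedSpace ℝ EN] [TopologicalSpace HN]
  [TopologicalSpace N] [ChartedSpace HN N] {J : ModelWithCorners ℝ EN HN}
  [NormedAddCommGroup EP] [NormedSpace ℝ EP] [TopologicalSpace HP]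
  [TopologicalSpace P] [ChartedSpace HP P] {K : ModelWithCorners ℝ EP HP}
  [NormedAddCommGroup F] [NormedSpace ℝ F]
  [TopologicalSpace S]
  [IsManifold I ∞ M] [IsManifold J ∞ N] [IsManifold K ∞ P]

open Manifold in
/-- The chart of a fibre product `S = M ×_N P`, with projections `a` and `b`, that is induced by a
presentation of the submersion `f : M → N` near `a x` as a linear projection. -/
def chart {f : M → N} (hf : IsSubmersionOfComplement F I J ∞ f) {g : P → N} (hg : Continuous g)
    {a : S → M} {b : S → P} (he : IsEmbedding fun x => (a x, b x))
    (hr : range (fun x => (a x, b x)) = {q : M × P | f q.1 = g q.2}) (x : S) :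
    OpenPartialHomeomorph S (P × F) := by
  classical
  let φ := (hf (a x)).domChart
  let ψ := (hf (a x)).codChart
  let L := (hf (a x)).equiv
  have hsrc : φ.source ⊆ f ⁻¹' ψ.source := (hf (a x)).source_subset_preimage_source
  have hw := (hf (a x)).writtenInCharts
  let lift : P × F → M := fun q => (φ.extend I).symm (L.symm (ψ.extend J (g q.1), q.2))
  let T : Set (P × F) := {q | g q.1 ∈ ψ.source ∧
    L.symm (ψ.extend J (g q.1), q.2) ∈ (φ.extend I).target}
  have key : ∀ q ∈ T, ∃ y : S, a y = lift q ∧ b y = q.1 := by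
    intro q hq
    have h1 : lift q ∈ φ.source := by
      have := (φ.extend I).map_target hq.2
      rwa [OpenPartialHomeomorph.extend_source] at this
    have h2 := hw hq.2
    simp only [Function.comp_apply] at h2
    have h3 : f (lift q) = g q.1 := by
      refine (ψ.extend J).injOn ?_ ?_ ?_
      · rw [OpenPartialHomeomorph.extend_source]; exact hsrc h1
      · rw [OpenPartialHomeomorph.extend_source]; exact hq.1
      · change (ψ.extend J) (f (lift q)) = Prod.fst (L (L.symm (ψ.extend J (g q.1), q.2))) at h2
        rw [h2, ContinuousLinearEquiv.apply_symm_apply]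
    have h4 : (lift q, q.1) ∈ range (fun x => (a x, b x)) := by rw [hr]; exact h3
    obtain ⟨y, hy⟩ := h4
    exact ⟨y, congrArg Prod.fst hy, congrArg Prod.snd hy⟩
  let inv : P × F → S := fun q => if h : q ∈ T then (key q h).choose else x
  have inv_a : ∀ q ∈ T, a (inv q) = lift q := fun q hq => by
    simp only [inv, dif_pos hq]; exact (key q hq).choose_spec.1
  have inv_b : ∀ q ∈ T, b (inv q) = q.1 := fun q hq => by
    simp only [inv, dif_pos hq]; exact (key q hq).choose_spec.2
  have hS : ∀ y : S, f (a y) = g (b y) := fun y => by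
    have : (a y, b y) ∈ range (fun x => (a x, b x)) := ⟨y, rfl⟩
    rw [hr] at this; exact this
  have ca : Continuous a := continuous_fst.comp he.continuous
  have cb : Continuous b := continuous_snd.comp he.continuous
  have hback : ∀ y, a y ∈ φ.source →
      L.symm (ψ.extend J (g (b y)), (L (φ.extend I (a y))).2) = φ.extend I (a y) := by
    intro y hy
    have h0 : φ.extend I (a y) ∈ (φ.extend I).target := by
      apply (φ.extend I).map_source; rwa [OpenPartialHomeomorph.extend_source]
    have h2 := hw h0
    change (ψ.extend J) (f ((φ.extend I).symm (φ.extend I (a y)))) = (L (φ.extend I (a y))).1 at h2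
    rw [(φ.extend I).left_inv (by rwa [OpenPartialHomeomorph.extend_source]), hS] at h2
    rw [h2, Prod.mk.eta, ContinuousLinearEquiv.symm_apply_apply]
  have cψ : ContinuousOn (fun q : P × F => L.symm (ψ.extend J (g q.1), q.2))
      {q | g q.1 ∈ ψ.source} := by
    refine L.symm.continuous.comp_continuousOn (ContinuousOn.prodMk ?_ continuous_snd.continuousOn)
    refine (ψ.continuousOn_extend (I := J)).comp (hg.comp continuous_fst).continuousOn ?_
    intro q hq; rw [OpenPartialHomeomorph.extend_source]; exact hq
  exact
  { toFun := fun y => (b y, (L (φ.extend I (a y))).2)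
    invFun := inv
    source := a ⁻¹' φ.source
    target := T
    map_source' := by
      intro y hy
      refine ⟨?_, ?_⟩
      · change g (b y) ∈ ψ.source
        rw [← hS]; exact hsrc hy
      · change L.symm (ψ.extend J (g (b y)), (L (φ.extend I (a y))).2) ∈ _
        rw [hback y hy]
        apply (φ.extend I).map_source; rwa [OpenPartialHomeomorph.extend_source]
    map_target' := by
      intro q hq
      change a (inv q) ∈ φ.source
      rw [inv_a q hq]
      have := (φ.extend I).map_target hq.2
      rwa [OpenPartialHomeomorph.extend_source] at this
    left_inv' := by
      intro y hy
      have hT : (b y, (L (φ.extend I (a y))).2) ∈ T := by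
        refine ⟨?_, ?_⟩
        · change g (b y) ∈ ψ.source
          rw [← hS]; exact hsrc hy
        · change L.symm (ψ.extend J (g (b y)), (L (φ.extend I (a y))).2) ∈ _
          rw [hback y hy]
          apply (φ.extend I).map_source; rwa [OpenPartialHomeomorph.extend_source]
      apply he.injective
      refine Prod.ext ?_ ?_
      · change a (inv _) = a y
        rw [inv_a _ hT]
        change (φ.extend I).symm (L.symm (ψ.extend J (g (b y)), (L (φ.extend I (a y))).2)) = _
        rw [hback y hy]
        exact (φ.extend I).left_inv (by rwa [OpenPartialHomeomorph.extend_source])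
      · exact inv_b _ hT
    right_inv' := by
      intro q hq
      refine Prod.ext (inv_b q hq) ?_
      change (L (φ.extend I (a (inv q)))).2 = q.2
      rw [inv_a q hq]
      change (L (φ.extend I ((φ.extend I).symm _))).2 = q.2
      rw [(φ.extend I).right_inv hq.2, ContinuousLinearEquiv.apply_symm_apply]
    open_source := φ.open_source.preimage ca
    open_target := by
      have hO : IsOpen {q : P × F | g q.1 ∈ ψ.source} :=
        ψ.open_source.preimage (hg.comp continuous_fst)
      exact cψ.isOpen_inter_preimage hO φ.isOpen_extend_target
    continuousOn_toFun := by
      refine cb.continuousOn.prodMk (continuous_snd.comp_continuousOn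
        (L.continuous.comp_continuousOn ?_))
      refine (φ.continuousOn_extend (I := I)).comp ca.continuousOn ?_
      intro y hy; rw [OpenPartialHomeomorph.extend_source]; exact hy
    continuousOn_invFun := by
      rw [he.continuousOn_iff]
      have : ContinuousOn (fun q => (lift q, q.1)) T := by
        refine ContinuousOn.prodMk ?_ continuous_fst.continuousOn
        exact (φ.continuousOn_extend_symm (I := I)).comp (cψ.mono fun q hq => hq.1)
          fun q hq => hq.2
      refine this.congr fun q hq => ?_
      exact Prod.ext (inv_a q hq) (inv_b q hq) }

section
variable {f : M → N} (hf : Manifold.IsSubmersionOfComplement F I J ∞ f) {g : P → N}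
  (hg : Continuous g) {a : S → M} {b : S → P} (he : IsEmbedding fun x => (a x, b x))
  (hr : range (fun x => (a x, b x)) = {q : M × P | f q.1 = g q.2})

theorem mem_source (x : S) : x ∈ (chart hf hg he hr x).source :=
  (hf (a x)).mem_domChart_source

theorem snd_symm (x : S) {q : P × F} (hq : q ∈ (chart hf hg he hr x).target) :
    b ((chart hf hg he hr x).symm q) = q.1 :=
  congrArg Prod.fst ((chart hf hg he hr x).right_inv hq)

theorem fst_symm (x : S) {q : P × F} (hq : q ∈ (chart hf hg he hr x).target) :
    a ((chart hf hg he hr x).symm q) = ((hf (a x)).domChart.extend I).symm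
      ((hf (a x)).equiv.symm ((hf (a x)).codChart.extend J (g q.1), q.2)) := by
  have hy := (chart hf hg he hr x).map_target hq
  set y := (chart hf hg he hr x).symm q with hy_def
  have hya : a y ∈ (hf (a x)).domChart.source := hy
  have hr1 : (chart hf hg he hr x) y = q := (chart hf hg he hr x).right_inv hq
  have hr2 : ((hf (a x)).equiv ((hf (a x)).domChart.extend I (a y))).2 = q.2 :=
    congrArg Prod.snd hr1
  have hr3 : b y = q.1 := congrArg Prod.fst hr1
  have hS : f (a y) = g (b y) := by
    have : (a y, b y) ∈ range (fun x => (a x, b x)) := ⟨y, rfl⟩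
    rw [hr] at this; exact this
  have hs : a y ∈ ((hf (a x)).domChart.extend I).source := by
    rwa [OpenPartialHomeomorph.extend_source]
  have h2 := (hf (a x)).writtenInCharts (((hf (a x)).domChart.extend I).map_source hs)
  simp only [Function.comp_apply] at h2
  rw [((hf (a x)).domChart.extend I).left_inv hs, hS, hr3] at h2
  rw [h2, ← hr2, Prod.mk.eta, ContinuousLinearEquiv.symm_apply_apply,
    ((hf (a x)).domChart.extend I).left_inv hs]

theorem contMDiffOn_fst_symm (hgs : ContMDiff K J ∞ g) (x : S) :
    ContMDiffOn (K.prod 𝓘(ℝ, F)) I ∞ (fun q => a ((chart hf hg he hr x).symm q))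
      (chart hf hg he hr x).target := by
  have h1 : ContMDiffOn (K.prod 𝓘(ℝ, F)) 𝓘(ℝ, EN × F) ∞
      (fun q : P × F => ((hf (a x)).codChart.extend J (g q.1), q.2))
      (chart hf hg he hr x).target := by
    refine ContMDiffOn.prodMk_space ?_ contMDiff_snd.contMDiffOn
    refine ((hf (a x)).codChart.contMDiffOn_extend
      (hf (a x)).codChart_mem_maximalAtlas).comp (hgs.comp contMDiff_fst).contMDiffOn ?_
    intro q hq
    exact hq.1
  have h2 := (hf (a x)).equiv.symm.contDiff.contMDiff.comp_contMDiffOn h1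
  have h3 := (contMDiffOn_extend_symm (I := I) (n := ∞)
    (hf (a x)).domChart_mem_maximalAtlas).comp h2 (s := (chart hf hg he hr x).target) ?_
  · exact h3.congr fun q hq => fst_symm hf hg he hr x hq
  · intro q hq
    have := hq.2
    rwa [OpenPartialHomeomorph.extend_target'] at this

/-- The atlas of a fibre product. -/
@[reducible]
def chartedSpace : ChartedSpace (P × F) S where
  atlas := range (chart hf hg he hr)
  chartAt := chart hf hg he hr
  mem_chart_source := mem_source hf hg he hr
  chart_mem_atlas x := ⟨x, rfl⟩

/-- The fibre product is modelled on the product of the model of `P` and the complement `F`. -/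
@[reducible]
def chartedSpaceModel : ChartedSpace (ModelProd HP F) S :=
  letI := chartedSpace hf hg he hr
  ChartedSpace.comp (ModelProd HP F) (P × F) S

theorem contMDiffOn_trans (hgs : ContMDiff K J ∞ g) (x y : S) :
    ContMDiffOn (K.prod 𝓘(ℝ, F)) (K.prod 𝓘(ℝ, F)) ∞
      ((chart hf hg he hr x).symm ≫ₕ chart hf hg he hr y)
      ((chart hf hg he hr x).symm ≫ₕ chart hf hg he hr y).source := by
  have hsub : ((chart hf hg he hr x).symm ≫ₕ chart hf hg he hr y).source ⊆
      (chart hf hg he hr x).target := by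
    rw [OpenPartialHomeomorph.trans_source]; exact fun q hq => hq.1
  have h1 := (contMDiffOn_fst_symm hf hg he hr hgs x).mono hsub
  refine ContMDiffOn.prodMk (f := fun q => b ((chart hf hg he hr x).symm q)) ?_ ?_
  · exact contMDiff_fst.contMDiffOn.congr fun q hq => snd_symm hf hg he hr x (hsub hq)
  · refine (contDiff_snd.contMDiff.comp_contMDiffOn
      ((hf (a y)).equiv.contDiff.contMDiff.comp_contMDiffOn
      (((hf (a y)).domChart.contMDiffOn_extend (hf (a y)).domChart_mem_maximalAtlas).comp h1 ?_)))
    intro q hq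
    exact hq.2

end

/-- Local diffeomorphisms of a manifold, as a pregroupoid. -/
def smoothPregroupoid (K : ModelWithCorners ℝ EP HP) (P : Type*) [TopologicalSpace P]
    [ChartedSpace HP P] : Pregroupoid P where
  property f s := ContMDiffOn K K ∞ f s
  comp hf hg _ _ _ := hg.comp (hf.mono inter_subset_left) inter_subset_right
  id_mem := contMDiff_id.contMDiffOn
  locality _ h := contMDiffOn_of_locally_contMDiffOn h
  congr _ h hf := hf.congr h

theorem isManifold_comp [ChartedSpace P S]
    (h : ∀ e ∈ atlas P S, ∀ e' ∈ atlas P S,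
      ContMDiffOn K K ∞ (e.symm ≫ₕ e') (e.symm ≫ₕ e').source) :
    @IsManifold ℝ _ EP _ _ HP _ K ∞ S _ (ChartedSpace.comp HP P S) := by
  let _ := ChartedSpace.comp HP P S
  have : HasGroupoid S (smoothPregroupoid K P).groupoid :=
    hasGroupoid_of_pregroupoid _ fun he he' => h _ he _ he'
  refine { StructureGroupoid.HasGroupoid.comp (smoothPregroupoid K P).groupoid ?_ with }
  intro e he
  rw [isLocalStructomorphOn_contDiffGroupoid_iff]
  exact mem_groupoid_of_pregroupoid.1 he

section
variable {f : M → N} (hf : Manifold.IsSubmersionOfComplement F I J ∞ f) {g : P → N}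
  (hg : Continuous g) {a : S → M} {b : S → P} (he : IsEmbedding fun x => (a x, b x))
  (hr : range (fun x => (a x, b x)) = {q : M × P | f q.1 = g q.2})

theorem isManifold (hgs : ContMDiff K J ∞ g) : @IsManifold ℝ _ (EP × F) _ _ (ModelProd HP F) _ (K.prod 𝓘(ℝ, F)) ∞ S _
    (chartedSpaceModel (HP := HP) hf hg he hr) := by
  let _ := chartedSpace hf hg he hr
  refine isManifold_comp (P := P × F) (K := K.prod 𝓘(ℝ, F)) ?_
  rintro _ ⟨x, rfl⟩ _ ⟨y, rfl⟩
  exact contMDiffOn_trans hf hg he hr hgs x y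

theorem contMDiffAt_symm (hgs : ContMDiff K J ∞ g) (x : S) :
    letI := chartedSpaceModel (HP := HP) hf hg he hr
    ContMDiffAt (K.prod 𝓘(ℝ, F)) (K.prod 𝓘(ℝ, F)) ∞ (chart hf hg he hr x).symm
      (chart hf hg he hr x x) := by
  let _ := chartedSpaceModel (HP := HP) hf hg he hr
  have := isManifold hf hg he hr hgs
  let e := chart hf hg he hr x
  let c := chartAt (ModelProd HP F) (e x)
  have hc : chartAt (ModelProd HP F) x = e ≫ₕ c := rfl
  have hx : x ∈ e.source := mem_source hf hg he hr x
  have h1 : ContMDiffAt (K.prod 𝓘(ℝ, F)) (K.prod 𝓘(ℝ, F)) ∞ (e ≫ₕ c).symm (c (e x)) := by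
    have := contMDiffAt_symm_of_mem_maximalAtlas (I := K.prod 𝓘(ℝ, F)) (n := ∞)
      (IsManifold.chart_mem_maximalAtlas x)
      (mem_chart_target (ModelProd HP F) x)
    exact this
  have h2 : ContMDiffAt (K.prod 𝓘(ℝ, F)) (K.prod 𝓘(ℝ, F)) ∞ c (e x) :=
    contMDiffAt_of_mem_maximalAtlas (IsManifold.chart_mem_maximalAtlas (e x))
      (mem_chart_source _ _)
  refine (h1.comp (e x) h2).congr_of_eventuallyEq ?_
  filter_upwards [c.open_source.mem_nhds (mem_chart_source _ (e x))] with z hz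
  change e.symm z = e.symm (c.symm (c z))
  rw [c.left_inv hz]

theorem contMDiffAt_chart_self (hgs : ContMDiff K J ∞ g) (x : S) :
    letI := chartedSpaceModel (HP := HP) hf hg he hr
    ContMDiffAt (K.prod 𝓘(ℝ, F)) (K.prod 𝓘(ℝ, F)) ∞ (chart hf hg he hr x) x := by
  let _ := chartedSpaceModel (HP := HP) hf hg he hr
  have := isManifold hf hg he hr hgs
  let e := chart hf hg he hr x
  let c := chartAt (ModelProd HP F) (e x)
  have hx : x ∈ e.source := mem_source hf hg he hr x
  have h1 : ContMDiffAt (K.prod 𝓘(ℝ, F)) (K.prod 𝓘(ℝ, F)) ∞ (e ≫ₕ c) x :=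
    contMDiffAt_of_mem_maximalAtlas (I := K.prod 𝓘(ℝ, F)) (n := ∞)
      (IsManifold.chart_mem_maximalAtlas x)
      (mem_chart_source (ModelProd HP F) x)
  have h2 : ContMDiffAt (K.prod 𝓘(ℝ, F)) (K.prod 𝓘(ℝ, F)) ∞ c.symm (c (e x)) :=
    contMDiffAt_symm_of_mem_maximalAtlas (IsManifold.chart_mem_maximalAtlas (e x))
      (mem_chart_target _ _)
  refine (h2.comp x h1).congr_of_eventuallyEq ?_
  filter_upwards [(e ≫ₕ c).open_source.mem_nhds (mem_chart_source (ModelProd HP F) x)] with z hz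
  rw [OpenPartialHomeomorph.trans_source] at hz
  change e z = c.symm (c (e z))
  rw [c.left_inv hz.2]

theorem contMDiffOn_chart (hgs : ContMDiff K J ∞ g) (x : S) :
    letI := chartedSpaceModel (HP := HP) hf hg he hr
    ContMDiffOn (K.prod 𝓘(ℝ, F)) (K.prod 𝓘(ℝ, F)) ∞ (chart hf hg he hr x)
      (chart hf hg he hr x).source := by
  let _ := chartedSpaceModel (HP := HP) hf hg he hr
  have := isManifold hf hg he hr hgs
  intro y hy
  let e := chart hf hg he hr y
  let e' := chart hf hg he hr x
  have hye : y ∈ e.source := mem_source hf hg he hr y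
  have h0 : e y ∈ (e.symm ≫ₕ e').source := by
    rw [OpenPartialHomeomorph.trans_source]
    refine ⟨e.map_source hye, ?_⟩
    change e.symm (e y) ∈ e'.source
    rwa [e.left_inv hye]
  have h1 := (contMDiffOn_trans hf hg he hr hgs y x).contMDiffAt
    ((e.symm ≫ₕ e').open_source.mem_nhds h0)
  have h2 := contMDiffAt_chart_self hf hg he hr hgs y
  refine ContMDiffAt.contMDiffWithinAt ((h1.comp y h2).congr_of_eventuallyEq ?_)
  filter_upwards [e.open_source.mem_nhds hye] with z hz
  change e' z = e' (e.symm (e z))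
  rw [e.left_inv hz]

theorem contMDiffOn_chart_symm (hgs : ContMDiff K J ∞ g) (x : S) :
    letI := chartedSpaceModel (HP := HP) hf hg he hr
    ContMDiffOn (K.prod 𝓘(ℝ, F)) (K.prod 𝓘(ℝ, F)) ∞ (chart hf hg he hr x).symm
      (chart hf hg he hr x).target := by
  let _ := chartedSpaceModel (HP := HP) hf hg he hr
  have := isManifold hf hg he hr hgs
  intro q hq
  let e' := chart hf hg he hr x
  let y := e'.symm q
  let e := chart hf hg he hr y
  have hye : y ∈ e.source := mem_source hf hg he hr y
  have h0 : q ∈ (e'.symm ≫ₕ e).source := by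
    rw [OpenPartialHomeomorph.trans_source]
    exact ⟨hq, hye⟩
  have h1 := (contMDiffOn_trans hf hg he hr hgs x y).contMDiffAt
    ((e'.symm ≫ₕ e).open_source.mem_nhds h0)
  have h2 := contMDiffAt_symm hf hg he hr hgs y
  refine ContMDiffAt.contMDiffWithinAt ((h2.comp q h1).congr_of_eventuallyEq ?_)
  filter_upwards [(e'.symm ≫ₕ e).open_source.mem_nhds h0] with z hz
  rw [OpenPartialHomeomorph.trans_source] at hz
  change e'.symm z = e.symm (e (e'.symm z))
  rw [e.left_inv hz.2]

theorem contMDiff_snd (hgs : ContMDiff K J ∞ g) :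
    letI := chartedSpaceModel (HP := HP) hf hg he hr
    ContMDiff (K.prod 𝓘(ℝ, F)) K ∞ b := by
  let _ := chartedSpaceModel (HP := HP) hf hg he hr
  intro x
  exact (contMDiff_fst (I := K) (J := 𝓘(ℝ, F))).contMDiffAt.comp x
    (contMDiffAt_chart_self hf hg he hr hgs x)

theorem contMDiff_fst (hgs : ContMDiff K J ∞ g) :
    letI := chartedSpaceModel (HP := HP) hf hg he hr
    ContMDiff (K.prod 𝓘(ℝ, F)) I ∞ a := by
  let _ := chartedSpaceModel (HP := HP) hf hg he hr
  intro x
  let e := chart hf hg he hr x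
  have hx : x ∈ e.source := mem_source hf hg he hr x
  have h1 := (contMDiffOn_fst_symm hf hg he hr hgs x).contMDiffAt
    (e.open_target.mem_nhds (e.map_source hx))
  refine (h1.comp x (contMDiffAt_chart_self hf hg he hr hgs x)).congr_of_eventuallyEq ?_
  filter_upwards [e.open_source.mem_nhds hx] with z hz
  change a z = a (e.symm (e z))
  rw [e.left_inv hz]

theorem contMDiffOn_lift (hgs : ContMDiff K J ∞ g) {EQ HQ Q : Type*} [NormedAddCommGroup EQ] [NormedSpace ℝ EQ]
    [TopologicalSpace HQ] [TopologicalSpace Q] [ChartedSpace HQ Q] {I' : ModelWithCorners ℝ EQ HQ}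
    {h : Q → S} {s : Set Q} (ha : ContMDiffOn I' I ∞ (fun z => a (h z)) s)
    (hb : ContMDiffOn I' K ∞ (fun z => b (h z)) s) :
    letI := chartedSpaceModel (HP := HP) hf hg he hr
    ContMDiffOn I' (K.prod 𝓘(ℝ, F)) ∞ h s := by
  let _ := chartedSpaceModel (HP := HP) hf hg he hr
  intro z hz
  let e := chart hf hg he hr (h z)
  have hx : h z ∈ e.source := mem_source hf hg he hr (h z)
  have hc : ContinuousOn h s := he.continuousOn_iff.2 (ha.continuousOn.prodMk hb.continuousOn)
  have h1 : ContMDiffWithinAt I' (K.prod 𝓘(ℝ, F)) ∞ (fun w => e (h w)) s z := by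
    refine ContMDiffWithinAt.prodMk (f := fun w => b (h w)) (hb z hz) ?_
    refine contDiff_snd.contMDiff.contMDiffAt.comp_contMDiffWithinAt z
      ((hf (a (h z))).equiv.contDiff.contMDiff.contMDiffAt.comp_contMDiffWithinAt z ?_)
    exact ((hf (a (h z))).domChart.contMDiffAt_extend (hf (a (h z))).domChart_mem_maximalAtlas
      hx).comp_contMDiffWithinAt z (ha z hz)
  refine ((contMDiffAt_symm hf hg he hr hgs (h z)).comp_contMDiffWithinAt z
    h1).congr_of_eventuallyEq ?_ ?_
  · filter_upwards [(hc z hz).preimage_mem_nhdsWithin (e.open_source.mem_nhds hx)] with w hw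
    change h w = e.symm (e (h w))
    rw [e.left_inv hw]
  · change h z = e.symm (e (h z))
    rw [e.left_inv hx]

open Manifold in
/-- The base change of a submersion is a submersion. -/
theorem isSubmersion_snd (hgs : ContMDiff K J ∞ g) :
    letI := chartedSpaceModel (HP := HP) hf hg he hr
    IsSubmersionOfComplement F (K.prod 𝓘(ℝ, F)) K ∞ b := by
  let _ := chartedSpaceModel (HP := HP) hf hg he hr
  have := isManifold hf hg he hr hgs
  intro x
  refine IsSubmersionAtOfComplement.mk_of_charts (ContinuousLinearEquiv.refl ℝ (EP × F))
    (chartAt (ModelProd HP F) x) (chartAt HP (b x)) (mem_chart_source _ x) (mem_chart_source _ _)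
    (IsManifold.chart_mem_maximalAtlas x) (IsManifold.chart_mem_maximalAtlas (b x)) ?_ ?_
  · intro y hy
    have hy2 : y ∈ (chart hf hg he hr x ≫ₕ
        (chartAt HP (b x)).prod (chartAt F (chart hf hg he hr x x).2)).source := hy
    rw [OpenPartialHomeomorph.trans_source] at hy2
    exact hy2.2.1
  · intro z hz
    have hz2 : (K.prod 𝓘(ℝ, F)).symm z ∈ (chart hf hg he hr x ≫ₕ
        (chartAt HP (b x)).prod (chartAt F (chart hf hg he hr x x).2)).target := by
      rw [OpenPartialHomeomorph.extend_target] at hz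
      exact hz.1
    have hz3 : z.1 ∈ range K := by
      rw [OpenPartialHomeomorph.extend_target, ModelWithCorners.range_prod] at hz
      exact hz.2.1
    rw [OpenPartialHomeomorph.trans_target] at hz2
    have h1 : K.symm z.1 ∈ (chartAt HP (b x)).target := hz2.1.1
    have h2 := snd_symm hf hg he hr x hz2.2
    refine (congrArg (fun w => K (chartAt HP (b x) w)) h2).trans ?_
    change K (chartAt HP (b x) ((chartAt HP (b x)).symm (K.symm z.1))) = z.1
    rw [(chartAt HP (b x)).right_inv h1, K.right_inv hz3]
end
end FiberChart

namespace Manifold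
variable {EM HM M EN HN N EP HP P F : Type*}
  [NormedAddCommGroup EM] [NormedSpace ℝ EM] [TopologicalSpace HM]
  [TopologicalSpace M] [ChartedSpace HM M] {I : ModelWithCorners ℝ EM HM}
  [NormedAddCommGroup EN] [NormedSpace ℝ EN] [TopologicalSpace HN]
  [TopologicalSpace N] [ChartedSpace HN N] {J : ModelWithCorners ℝ EN HN}
  [NormedAddCommGroup EP] [NormedSpace ℝ EP] [TopologicalSpace HP]
  [TopologicalSpace P] [ChartedSpace HP P] {K : ModelWithCorners ℝ EP HP}
  [NormedAddCommGroup F] [NormedSpace ℝ F]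
  [IsManifold I ∞ M] [IsManifold J ∞ N] [IsManifold K ∞ P]

theorem IsSubmersion.finrankComplement [FiniteDimensional ℝ EM] {f : M → N}
    (hf : IsSubmersion I J ∞ f) :
    IsSubmersionOfComplement
      (EuclideanSpace ℝ (Fin (Module.finrank ℝ EM - Module.finrank ℝ EN))) I J ∞ f := by
  intro x
  let hx := hf.isSubmersionAt x
  let L := hx.equiv
  have : FiniteDimensional ℝ (EN × hx.complement) := L.toLinearEquiv.finiteDimensional
  have : FiniteDimensional ℝ EN :=
    FiniteDimensional.of_surjective (LinearMap.fst ℝ EN hx.complement) LinearMap.fst_surjective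
  have : FiniteDimensional ℝ hx.complement :=
    FiniteDimensional.of_surjective (LinearMap.snd ℝ EN hx.complement) LinearMap.snd_surjective
  have hd : Module.finrank ℝ EM = Module.finrank ℝ EN + Module.finrank ℝ hx.complement := by
    rw [L.toLinearEquiv.finrank_eq, Module.finrank_prod]
  refine hx.isSubmersionAtOfComplement_complement.trans_F (ContinuousLinearEquiv.ofFinrankEq ?_)
  rw [finrank_euclideanSpace_fin, hd, Nat.add_sub_cancel_left]

theorem IsSubmersion.comp_fst {f : M → N} (hf : IsSubmersion I J ∞ f) :
    IsSubmersion (I.prod K) J ∞ (fun z : M × P => f z.1) := by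
  refine IsSubmersionOfComplement.isSubmersion (F := hf.complement × EP) fun x => ?_
  let hx := hf.isSubmersionOfComplement_complement x.1
  refine IsSubmersionAtOfComplement.mk_of_charts
    ((hx.equiv.prodCongr (ContinuousLinearEquiv.refl ℝ EP)).trans
      (ContinuousLinearEquiv.prodAssoc ℝ EN hf.complement EP))
    (hx.domChart.prod (chartAt HP x.2)) hx.codChart ⟨hx.mem_domChart_source, mem_chart_source _ _⟩
    hx.mem_codChart_source ?_ hx.codChart_mem_maximalAtlas ?_ ?_
  · exact IsManifold.mem_maximalAtlas_prod hx.domChart_mem_maximalAtlas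
      (IsManifold.chart_mem_maximalAtlas _)
  · intro y hy
    exact hx.source_subset_preimage_source hy.1
  · intro z hz
    rw [OpenPartialHomeomorph.extend_prod] at hz
    exact hx.writtenInCharts hz.1

theorem IsSubmersion.comp_diffeomorph {f : M → N} (hf : IsSubmersion I J ∞ f)
    (Φ : Diffeomorph I I M M ∞) :
    IsSubmersion I J ∞ (f ∘ Φ) := by
  refine IsSubmersionOfComplement.isSubmersion (F := hf.complement) fun x => ?_
  let hx := hf.isSubmersionOfComplement_complement (Φ x)
  let φ := Φ.toHomeomorph.toOpenPartialHomeomorph ≫ₕ hx.domChart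
  have hs : φ.source = Φ ⁻¹' hx.domChart.source := by
    rw [OpenPartialHomeomorph.trans_source]; simp
  refine IsSubmersionAtOfComplement.mk_of_charts hx.equiv φ hx.codChart ?_
    hx.mem_codChart_source ?_ hx.codChart_mem_maximalAtlas ?_ ?_
  · rw [hs]; exact hx.mem_domChart_source
  · refine φ.mem_maximalAtlas_of_contMDiffOn ?_ ?_
    · rw [hs]
      exact (contMDiffOn_of_mem_maximalAtlas hx.domChart_mem_maximalAtlas).comp
        Φ.contMDiff.contMDiffOn subset_rfl
    · have ht : φ.target ⊆ hx.domChart.target := by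
        rw [OpenPartialHomeomorph.trans_target]; exact inter_subset_left
      exact Φ.symm.contMDiff.comp_contMDiffOn
        ((contMDiffOn_symm_of_mem_maximalAtlas hx.domChart_mem_maximalAtlas).mono ht)
  · rw [hs]; intro y hy
    exact hx.source_subset_preimage_source hy
  · intro z hz
    have hz2 : z ∈ (hx.domChart.extend I).target := by
      rw [OpenPartialHomeomorph.extend_target] at hz ⊢
      refine ⟨?_, hz.2⟩
      have := hz.1
      rw [mem_preimage, OpenPartialHomeomorph.trans_target] at this
      exact this.1
    have h := hx.writtenInCharts hz2
    change hx.codChart.extend J (f (Φ (Φ.symm _))) = _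
    rw [Diffeomorph.apply_symm_apply]
    exact h
end Manifold



/-- A smooth manifold: finite dimensional, without boundary, Hausdorff and second countable. -/
structure Mfd : Type (u + 1) where
  carrier : Type u
  E : Type
  [normedAddCommGroup : NormedAddCommGroup E]
  [normedSpace : NormedSpace ℝ E]
  [finiteDimensional : FiniteDimensional ℝ E]
  H : Type
  [topH : TopologicalSpace H]
  I : ModelWithCorners ℝ E H
  [boundaryless : I.Boundaryless]
  [top : TopologicalSpace carrier]
  [charted : ChartedSpace H carrier]
  [isManifold : IsManifold I ∞ carrier]
  [t2 : T2Space carrier]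
  [secondCountable : SecondCountableTopology carrier]

namespace Mfd

instance : CoeSort Mfd.{u} (Type u) := ⟨Mfd.carrier⟩

attribute [instance] normedAddCommGroup normedSpace finiteDimensional topH boundaryless top charted
  isManifold t2 secondCountable

/-- Smooth maps between manifolds. -/
abbrev Smooth {M N : Mfd.{u}} (f : M → N) : Prop := ContMDiff M.I N.I ∞ f

/-- Surjective submersions. -/
structure SurjSubmersion {M N : Mfd.{u}} (f : M → N) : Prop where
  submersion : Manifold.IsSubmersion M.I N.I ∞ f
  surjective : Function.Surjective f

theorem SurjSubmersion.smooth {M N : Mfd.{u}} {f : M → N} (hf : SurjSubmersion f) : Smooth f :=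
  hf.submersion.contMDiff

/-- The product of two manifolds. -/
@[reducible]
def prod (M N : Mfd.{u}) : Mfd.{u} where
  carrier := M × N
  E := M.E × N.E
  H := ModelProd M.H N.H
  I := M.I.prod N.I

section fiberProd

variable {M N P : Mfd.{u}} {f : M → N} {g : P → N}

theorem isEmbedding_fiberProd (f : M → N) (g : P → N) :
    IsEmbedding fun x : {q : M × P // f q.1 = g q.2} => (x.1.1, x.1.2) :=
  IsEmbedding.subtypeVal

theorem range_fiberProd (f : M → N) (g : P → N) :
    range (fun x : {q : M × P // f q.1 = g q.2} => (x.1.1, x.1.2)) =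
      {q : M × P | f q.1 = g q.2} :=
  Subtype.range_coe

/-- The fibre product `M ×_N P` of a surjective submersion `f : M → N` and a smooth map
`g : P → N`, with its structure of embedded submanifold of `M × P`. -/
def fiberProd (f : M → N) (hf : SurjSubmersion f) (g : P → N) (hg : Smooth g) : Mfd.{u} where
  carrier := {q : M × P // f q.1 = g q.2}
  E := P.E × EuclideanSpace ℝ (Fin (Module.finrank ℝ M.E - Module.finrank ℝ N.E))
  H := ModelProd P.H (EuclideanSpace ℝ (Fin (Module.finrank ℝ M.E - Module.finrank ℝ N.E)))
  I := P.I.prod 𝓘(ℝ, EuclideanSpace ℝ (Fin (Module.finrank ℝ M.E - Module.finrank ℝ N.E)))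
  charted := FiberChart.chartedSpaceModel hf.submersion.finrankComplement hg.continuous
    (isEmbedding_fiberProd f g) (range_fiberProd f g)
  isManifold := FiberChart.isManifold hf.submersion.finrankComplement hg.continuous
    (isEmbedding_fiberProd f g) (range_fiberProd f g) hg
  secondCountable := IsEmbedding.subtypeVal.secondCountableTopology

variable {hf : SurjSubmersion f} {hg : Smooth g}

namespace fiberProd

/-- The point `(m, p)` of `M ×_N P`. -/
def mk (m : M) (p : P) (h : f m = g p) : fiberProd f hf g hg := ⟨(m, p), h⟩

/-- The projection `M ×_N P → M`. -/
def fst (x : fiberProd f hf g hg) : M := (x : {q : M × P // f q.1 = g q.2}).1.1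

/-- The projection `M ×_N P → P`. -/
def snd (x : fiberProd f hf g hg) : P := (x : {q : M × P // f q.1 = g q.2}).1.2

theorem condition (x : fiberProd f hf g hg) : f (fst x) = g (snd x) :=
  (x : {q : M × P // f q.1 = g q.2}).2

@[simp] theorem fst_mk (m : M) (p : P) (h : f m = g p) :
    fst (mk m p h : fiberProd f hf g hg) = m := rfl

@[simp] theorem snd_mk (m : M) (p : P) (h : f m = g p) :
    snd (mk m p h : fiberProd f hf g hg) = p := rfl

@[ext] theorem ext {x y : fiberProd f hf g hg} (h₁ : fst x = fst y) (h₂ : snd x = snd y) :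
    x = y := Subtype.ext (Prod.ext h₁ h₂)

theorem smooth_fst : Smooth (fst : fiberProd f hf g hg → M) :=
  FiberChart.contMDiff_fst hf.submersion.finrankComplement hg.continuous
    (isEmbedding_fiberProd f g) (range_fiberProd f g) hg

theorem smooth_snd : Smooth (snd : fiberProd f hf g hg → P) :=
  FiberChart.contMDiff_snd hf.submersion.finrankComplement hg.continuous
    (isEmbedding_fiberProd f g) (range_fiberProd f g) hg

theorem contMDiffOn_lift {EQ HQ Q : Type*} [NormedAddCommGroup EQ] [NormedSpace ℝ EQ]
    [TopologicalSpace HQ] [TopologicalSpace Q] [ChartedSpace HQ Q] {I' : ModelWithCorners ℝ EQ HQ}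
    {h : Q → fiberProd f hf g hg} {s : Set Q} (h₁ : ContMDiffOn I' M.I ∞ (fun z => fst (h z)) s)
    (h₂ : ContMDiffOn I' P.I ∞ (fun z => snd (h z)) s) :
    ContMDiffOn I' (fiberProd f hf g hg).I ∞ h s :=
  FiberChart.contMDiffOn_lift hf.submersion.finrankComplement hg.continuous
    (isEmbedding_fiberProd f g) (range_fiberProd f g) hg h₁ h₂

theorem smooth_lift {EQ HQ Q : Type*} [NormedAddCommGroup EQ] [NormedSpace ℝ EQ]
    [TopologicalSpace HQ] [TopologicalSpace Q] [ChartedSpace HQ Q] {I' : ModelWithCorners ℝ EQ HQ}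
    {h : Q → fiberProd f hf g hg} (h₁ : ContMDiff I' M.I ∞ fun z => fst (h z))
    (h₂ : ContMDiff I' P.I ∞ fun z => snd (h z)) :
    ContMDiff I' (fiberProd f hf g hg).I ∞ h :=
  contMDiffOn_univ.1 (contMDiffOn_lift h₁.contMDiffOn h₂.contMDiffOn)

theorem surjSubmersion_snd : SurjSubmersion (snd : fiberProd f hf g hg → P) where
  submersion := Manifold.IsSubmersionOfComplement.isSubmersion (I := (fiberProd f hf g hg).I)
    (M := fiberProd f hf g hg)
    (FiberChart.isSubmersion_snd hf.submersion.finrankComplement hg.continuous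
      (isEmbedding_fiberProd f g) (range_fiberProd f g) hg)
  surjective p := by
    obtain ⟨m, hm⟩ := hf.surjective (g p)
    exact ⟨mk m p hm, rfl⟩

end fiberProd

end fiberProd

section fiber

variable {M N : Mfd.{u}} {f : M → N}

theorem isEmbedding_fiber (f : M → N) (n : N) :
    IsEmbedding fun x : {m : M // f m = n} => (x.1, (0 : Fin 0 → ℝ)) :=
  (isEmbedding_prodMkLeft (0 : Fin 0 → ℝ)).comp IsEmbedding.subtypeVal

theorem range_fiber (f : M → N) (n : N) :
    range (fun x : {m : M // f m = n} => (x.1, (0 : Fin 0 → ℝ))) =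
      {q : M × (Fin 0 → ℝ) | f q.1 = (fun _ : Fin 0 → ℝ => n) q.2} := by
  ext ⟨m, z⟩
  refine ⟨?_, fun h => ⟨⟨m, h⟩, Prod.ext rfl (Subsingleton.elim _ _)⟩⟩
  rintro ⟨x, hx⟩
  have : x.1 = m := congrArg Prod.fst hx
  exact this ▸ x.2

/-- The fibre `f⁻¹(n)` of a surjective submersion, with its structure of embedded submanifold. -/
def fiber (f : M → N) (hf : SurjSubmersion f) (n : N) : Mfd.{u} where
  carrier := {m : M // f m = n}
  E := (Fin 0 → ℝ) × EuclideanSpace ℝ (Fin (Module.finrank ℝ M.E - Module.finrank ℝ N.E))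
  H := ModelProd (Fin 0 → ℝ)
    (EuclideanSpace ℝ (Fin (Module.finrank ℝ M.E - Module.finrank ℝ N.E)))
  I := 𝓘(ℝ, Fin 0 → ℝ).prod
    𝓘(ℝ, EuclideanSpace ℝ (Fin (Module.finrank ℝ M.E - Module.finrank ℝ N.E)))
  charted := FiberChart.chartedSpaceModel hf.submersion.finrankComplement
    (continuous_const (y := n)) (isEmbedding_fiber f n) (range_fiber f n)
  isManifold := FiberChart.isManifold hf.submersion.finrankComplement
    (continuous_const (y := n)) (isEmbedding_fiber f n) (range_fiber f n)
    (contMDiff_const (I := 𝓘(ℝ, Fin 0 → ℝ)))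
  secondCountable := IsEmbedding.subtypeVal.secondCountableTopology

variable {hf : SurjSubmersion f} {n : N}

namespace fiber

/-- The point `m` of `f⁻¹(n)`. -/
def mk (m : M) (h : f m = n) : fiber f hf n := ⟨m, h⟩

/-- The inclusion `f⁻¹(n) → M`. -/
def val (x : fiber f hf n) : M := (x : {m : M // f m = n}).1

theorem condition (x : fiber f hf n) : f (val x) = n := (x : {m : M // f m = n}).2

@[simp] theorem val_mk (m : M) (h : f m = n) : val (mk m h : fiber f hf n) = m := rfl

@[ext] theorem ext {x y : fiber f hf n} (h : val x = val y) : x = y := Subtype.ext h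

theorem smooth_val : Smooth (val : fiber f hf n → M) :=
  FiberChart.contMDiff_fst (K := 𝓘(ℝ, Fin 0 → ℝ)) hf.submersion.finrankComplement
    (continuous_const (y := n)) (isEmbedding_fiber f n) (range_fiber f n) contMDiff_const

theorem contMDiffOn_lift {EQ HQ Q : Type*} [NormedAddCommGroup EQ] [NormedSpace ℝ EQ]
    [TopologicalSpace HQ] [TopologicalSpace Q] [ChartedSpace HQ Q] {I' : ModelWithCorners ℝ EQ HQ}
    {h : Q → fiber f hf n} {s : Set Q} (h₁ : ContMDiffOn I' M.I ∞ (fun z => val (h z)) s) :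
    ContMDiffOn I' (fiber f hf n).I ∞ h s :=
  FiberChart.contMDiffOn_lift (K := 𝓘(ℝ, Fin 0 → ℝ)) hf.submersion.finrankComplement
    (continuous_const (y := n)) (isEmbedding_fiber f n) (range_fiber f n) contMDiff_const h₁
    contMDiffOn_const

end fiber

end fiber

end Mfd


/-! ### Lie groupoids -/

/-- A Lie groupoid `[Mor ⇉ Ob]`. The composite `comp γ₂ γ₁` is `γ₂ ∘ γ₁`: first `γ₁`, then
`γ₂`. -/
structure LieGroupoid : Type (u + 1) where
  Ob : Mfd.{u}
  Mor : Mfd.{u}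
  src : Mor → Ob
  tgt : Mor → Ob
  src_sub : Mfd.SurjSubmersion src
  tgt_sub : Mfd.SurjSubmersion tgt
  one : Ob → Mor
  inv : Mor → Mor
  comp (γ₂ γ₁ : Mor) (h : src γ₂ = tgt γ₁) : Mor
  src_one (x : Ob) : src (one x) = x
  tgt_one (x : Ob) : tgt (one x) = x
  src_inv (γ : Mor) : src (inv γ) = tgt γ
  tgt_inv (γ : Mor) : tgt (inv γ) = src γ
  src_comp (γ₂ γ₁ : Mor) (h : src γ₂ = tgt γ₁) : src (comp γ₂ γ₁ h) = src γ₁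
  tgt_comp (γ₂ γ₁ : Mor) (h : src γ₂ = tgt γ₁) : tgt (comp γ₂ γ₁ h) = tgt γ₂
  comp_assoc (γ₃ γ₂ γ₁ : Mor) (h₃₂ : src γ₃ = tgt γ₂) (h₂₁ : src γ₂ = tgt γ₁) :
    comp (comp γ₃ γ₂ h₃₂) γ₁ ((src_comp γ₃ γ₂ h₃₂).trans h₂₁) =
      comp γ₃ (comp γ₂ γ₁ h₂₁) (h₃₂.trans (tgt_comp γ₂ γ₁ h₂₁).symm)
  comp_one (γ : Mor) : comp γ (one (src γ)) (tgt_one (src γ)).symm = γ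
  one_comp (γ : Mor) : comp (one (tgt γ)) γ (src_one (tgt γ)) = γ
  comp_inv (γ : Mor) : comp γ (inv γ) (tgt_inv γ).symm = one (tgt γ)
  inv_comp (γ : Mor) : comp (inv γ) γ (src_inv γ) = one (src γ)
  smooth_one : Mfd.Smooth one
  smooth_inv : Mfd.Smooth inv
  /-- Composition is smooth on the manifold `Mor ×_Ob Mor` of composable pairs. -/
  smooth_comp : Mfd.Smooth fun x : Mfd.fiberProd src src_sub tgt tgt_sub.smooth =>
    comp (Mfd.fiberProd.fst x) (Mfd.fiberProd.snd x) (Mfd.fiberProd.condition x)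

namespace LieGroupoid

variable {X Y : LieGroupoid.{u}}

theorem comp_congr {γ₂ γ₁ δ₂ δ₁ : X.Mor} (h₂ : γ₂ = δ₂) (h₁ : γ₁ = δ₁) (h : X.src γ₂ = X.tgt γ₁) :
    X.comp γ₂ γ₁ h = X.comp δ₂ δ₁ (h₂ ▸ h₁ ▸ h) := by
  subst h₂ h₁; rfl

theorem contMDiff_comp {EQ HQ Q : Type*} [NormedAddCommGroup EQ] [NormedSpace ℝ EQ]
    [TopologicalSpace HQ] [TopologicalSpace Q] [ChartedSpace HQ Q] {I' : ModelWithCorners ℝ EQ HQ}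
    {c₂ c₁ : Q → X.Mor} (h₂ : ContMDiff I' X.Mor.I ∞ c₂) (h₁ : ContMDiff I' X.Mor.I ∞ c₁)
    (h : ∀ z, X.src (c₂ z) = X.tgt (c₁ z)) :
    ContMDiff I' X.Mor.I ∞ fun z => X.comp (c₂ z) (c₁ z) (h z) :=
  X.smooth_comp.comp (Mfd.fiberProd.smooth_lift
    (h := fun z => Mfd.fiberProd.mk (c₂ z) (c₁ z) (h z)) h₂ h₁)

theorem eq_inv_of_comp_eq_one {γ δ : X.Mor} (h : X.src δ = X.tgt γ)
    (hc : X.comp δ γ h = X.one (X.src γ)) : δ = X.inv γ := by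
  have h1 := X.comp_assoc δ γ (X.inv γ) h (X.tgt_inv γ).symm
  have h2 : X.comp (X.comp δ γ h) (X.inv γ) ((X.src_comp _ _ h).trans (X.tgt_inv γ).symm) =
      X.comp (X.one (X.tgt (X.inv γ))) (X.inv γ) (X.src_one _) :=
    comp_congr (hc.trans (congrArg X.one (X.tgt_inv γ).symm)) rfl _
  have h3 : X.comp δ (X.comp γ (X.inv γ) (X.tgt_inv γ).symm)
      (h.trans (X.tgt_comp _ _ _).symm) = X.comp δ (X.one (X.src δ)) (X.tgt_one _).symm :=
    comp_congr rfl ((X.comp_inv γ).trans (congrArg X.one h.symm)) _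
  rw [h2, h3, X.one_comp, X.comp_one] at h1
  exact h1.symm

theorem inv_inv (γ : X.Mor) : X.inv (X.inv γ) = γ :=
  (eq_inv_of_comp_eq_one (γ := X.inv γ) (X.tgt_inv γ).symm
    ((X.comp_inv γ).trans (congrArg X.one (X.src_inv γ).symm))).symm

/-- A morphism of Lie groupoids: a smooth functor. -/
structure Hom (X Y : LieGroupoid.{u}) where
  ob : X.Ob → Y.Ob
  mor : X.Mor → Y.Mor
  smooth_ob : Mfd.Smooth ob
  smooth_mor : Mfd.Smooth mor
  src_mor (γ : X.Mor) : Y.src (mor γ) = ob (X.src γ)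
  tgt_mor (γ : X.Mor) : Y.tgt (mor γ) = ob (X.tgt γ)
  mor_one (x : X.Ob) : mor (X.one x) = Y.one (ob x)
  mor_comp (γ₂ γ₁ : X.Mor) (h : X.src γ₂ = X.tgt γ₁) :
    mor (X.comp γ₂ γ₁ h) =
      Y.comp (mor γ₂) (mor γ₁) ((src_mor γ₂).trans ((congrArg ob h).trans (tgt_mor γ₁).symm))

end LieGroupoid

/-! ### Lie 2-groups and their crossed modules -/

/-- A strict Lie 2-group: a Lie groupoid with Lie group structures on objects and on morphisms
for which all structure maps are group homomorphisms. -/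
structure LieTwoGroup : Type (u + 1) extends LieGroupoid.{u} where
  [groupOb : Group Ob]
  [groupMor : Group Mor]
  [lieGroupOb : LieGroup Ob.I ∞ Ob]
  [lieGroupMor : LieGroup Mor.I ∞ Mor]
  src_mul (k l : Mor) : src (k * l) = src k * src l
  tgt_mul (k l : Mor) : tgt (k * l) = tgt k * tgt l
  one_mul (a b : Ob) : one (a * b) = one a * one b
  comp_mul (k₂ k₁ l₂ l₁ : Mor) (hk : src k₂ = tgt k₁) (hl : src l₂ = tgt l₁) :
    comp (k₂ * l₂) (k₁ * l₁) (by rw [src_mul, tgt_mul, hk, hl]) = comp k₂ k₁ hk * comp l₂ l₁ hl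

namespace LieTwoGroup

attribute [instance] groupOb groupMor lieGroupOb lieGroupMor

variable (G : LieTwoGroup.{u})

/-- The source map as a group homomorphism. -/
def srcHom : G.Mor →* G.Ob := MonoidHom.mk' G.src G.src_mul

/-- The target map as a group homomorphism. -/
def tgtHom : G.Mor →* G.Ob := MonoidHom.mk' G.tgt G.tgt_mul

/-- The unit map as a group homomorphism. -/
def oneHom : G.Ob →* G.Mor := MonoidHom.mk' G.one G.one_mul

theorem src_one' : G.src 1 = 1 := map_one G.srcHom
theorem tgt_one' : G.tgt 1 = 1 := map_one G.tgtHom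
theorem one_one : G.one 1 = 1 := map_one G.oneHom
theorem src_inv' (k : G.Mor) : G.src k⁻¹ = (G.src k)⁻¹ := map_inv G.srcHom k
theorem tgt_inv' (k : G.Mor) : G.tgt k⁻¹ = (G.tgt k)⁻¹ := map_inv G.tgtHom k
theorem one_inv' (a : G.Ob) : G.one a⁻¹ = (G.one a)⁻¹ := map_inv G.oneHom a

/-- The Lie group `H = ker (src)` of the Lie crossed module `(G₀, H, τ, α)` of a Lie 2-group. -/
def H : Mfd.{u} := Mfd.fiber G.src G.src_sub 1

/-- The inclusion `H → G₁`. -/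
def incl (h : G.H) : G.Mor := Mfd.fiber.val h

theorem src_incl (h : G.H) : G.src (G.incl h) = 1 := Mfd.fiber.condition h

variable {G} in
theorem H_ext {h h' : G.H} (e : G.incl h = G.incl h') : h = h' := Mfd.fiber.ext e

/-- An element of `G₁` with source `1`, as an element of `H`. -/
def toH (k : G.Mor) (hk : G.src k = 1) : G.H := Mfd.fiber.mk k hk

@[simp] theorem incl_toH (k : G.Mor) (hk : G.src k = 1) : G.incl (G.toH k hk) = k := rfl

theorem smooth_incl : Mfd.Smooth G.incl := Mfd.fiber.smooth_val

variable {G} in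
theorem contMDiffOn_H {EQ HQ Q : Type*} [NormedAddCommGroup EQ] [NormedSpace ℝ EQ]
    [TopologicalSpace HQ] [TopologicalSpace Q] [ChartedSpace HQ Q] {I' : ModelWithCorners ℝ EQ HQ}
    {f : Q → G.H} {s : Set Q} (hf : ContMDiffOn I' G.Mor.I ∞ (fun z => G.incl (f z)) s) :
    ContMDiffOn I' G.H.I ∞ f s :=
  Mfd.fiber.contMDiffOn_lift hf

variable {G} in
theorem contMDiff_H {EQ HQ Q : Type*} [NormedAddCommGroup EQ] [NormedSpace ℝ EQ]
    [TopologicalSpace HQ] [TopologicalSpace Q] [ChartedSpace HQ Q] {I' : ModelWithCorners ℝ EQ HQ}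
    {f : Q → G.H} (hf : ContMDiff I' G.Mor.I ∞ fun z => G.incl (f z)) :
    ContMDiff I' G.H.I ∞ f :=
  contMDiffOn_univ.1 (contMDiffOn_H hf.contMDiffOn)

instance : Group G.H where
  mul h h' := G.toH (G.incl h * G.incl h')
    (by rw [G.src_mul, G.src_incl, G.src_incl, mul_one])
  one := G.toH 1 G.src_one'
  inv h := G.toH (G.incl h)⁻¹ (by rw [G.src_inv', G.src_incl, _root_.inv_one])
  mul_assoc a b c := H_ext (mul_assoc (G.incl a) (G.incl b) (G.incl c))
  one_mul a := H_ext (_root_.one_mul (G.incl a))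
  mul_one a := H_ext (_root_.mul_one (G.incl a))
  inv_mul_cancel a := H_ext (inv_mul_cancel (G.incl a))

@[simp] theorem incl_mul (h h' : G.H) : G.incl (h * h') = G.incl h * G.incl h' := rfl
@[simp] theorem incl_inv (h : G.H) : G.incl h⁻¹ = (G.incl h)⁻¹ := rfl
@[simp] theorem incl_one : G.incl 1 = 1 := rfl

instance : LieGroup G.H.I ∞ G.H where
  contMDiff_mul := contMDiff_H ((G.smooth_incl.comp contMDiff_fst).mul
    (G.smooth_incl.comp contMDiff_snd))
  contMDiff_inv := contMDiff_H G.smooth_incl.inv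

/-- The homomorphism `τ : H → G₀`: the restriction of the target map. -/
def τ : G.H →* G.Ob :=
  MonoidHom.mk' (fun h => G.tgt (G.incl h)) fun a b => G.tgt_mul (G.incl a) (G.incl b)

theorem τ_apply (h : G.H) : G.τ h = G.tgt (G.incl h) := rfl

theorem smooth_τ : Mfd.Smooth G.τ := G.tgt_sub.smooth.comp G.smooth_incl

/-- The action `α : G₀ × H → H`, `α(a, h) = 1_a h 1_{a⁻¹}`. -/
def α (a : G.Ob) (h : G.H) : G.H :=
  G.toH (G.one a * G.incl h * G.one a⁻¹) (by
    rw [G.src_mul, G.src_mul, G.src_one, G.src_one, G.src_incl, mul_one, mul_inv_cancel])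

/-- The component `h` of `k ∈ G₁` under the identification `G₁ = H ⋊ G₀`, `(h, g) = h 1_g`; the
other component is `g = src k`. -/
def hPart (k : G.Mor) : G.H :=
  G.toH (k * G.one (G.src k)⁻¹) (by rw [G.src_mul, G.src_one, mul_inv_cancel])

theorem incl_act (k : G.Mor) (h : G.H) :
    G.incl (G.α (G.src k)⁻¹ ((G.hPart k)⁻¹ * h)) = k⁻¹ * G.incl h * G.one (G.src k) := by
  change G.one (G.src k)⁻¹ * ((k * G.one (G.src k)⁻¹)⁻¹ * G.incl h) * G.one (G.src k)⁻¹⁻¹ = _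
  rw [G.one_inv', _root_.inv_inv]
  group

theorem comp_eq (k₂ k₁ : G.Mor) (h : G.src k₂ = G.tgt k₁) :
    G.comp k₂ k₁ h = k₂ * (G.one (G.src k₂))⁻¹ * k₁ := by
  have h0 : G.src (k₂ * (G.one (G.src k₂))⁻¹) = 1 := by
    rw [G.src_mul, G.src_inv', G.src_one, mul_inv_cancel]
  have h1 := G.comp_mul (k₂ * (G.one (G.src k₂))⁻¹) (G.one 1) (G.one (G.tgt k₁)) k₁
    (h0.trans (G.tgt_one 1).symm) (G.src_one _)
  have h2 : G.comp (k₂ * (G.one (G.src k₂))⁻¹) (G.one 1) (h0.trans (G.tgt_one 1).symm) =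
      k₂ * (G.one (G.src k₂))⁻¹ :=
    (LieGroupoid.comp_congr (X := G.toLieGroupoid) rfl (congrArg G.one h0.symm) _).trans
      (G.comp_one _)
  rw [h2, G.one_comp] at h1
  rw [← h1]
  refine LieGroupoid.comp_congr (X := G.toLieGroupoid) ?_ ?_ _
  · rw [h, inv_mul_cancel_right]
  · rw [G.one_one, _root_.one_mul]

theorem commute_ker {a b : G.Mor} (ha : G.src a = 1) (hb : G.tgt b = 1) : a * b = b * a := by
  have e1 : G.src a = G.tgt b := ha.trans hb.symm
  have h1 := G.comp_mul (G.one 1) b a (G.one 1) ((G.src_one 1).trans hb.symm)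
    (ha.trans (G.tgt_one 1).symm)
  have h2 : G.comp (G.one 1) b ((G.src_one 1).trans hb.symm) = b :=
    (LieGroupoid.comp_congr (X := G.toLieGroupoid) (congrArg G.one hb.symm) rfl _).trans
      (G.one_comp _)
  have h3 : G.comp a (G.one 1) (ha.trans (G.tgt_one 1).symm) = a :=
    (LieGroupoid.comp_congr (X := G.toLieGroupoid) rfl (congrArg G.one ha.symm) _).trans
      (G.comp_one _)
  rw [h2, h3] at h1
  rw [← h1, LieGroupoid.comp_congr (X := G.toLieGroupoid) (δ₂ := a) (δ₁ := b)
    (by rw [G.one_one, _root_.one_mul]) (by rw [G.one_one, _root_.mul_one]), G.comp_eq, ha,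
    G.one_one, _root_.inv_one, _root_.mul_one]

theorem smooth_α : ContMDiff (G.Ob.I.prod G.H.I) G.H.I ∞ fun z : G.Ob × G.H => G.α z.1 z.2 := by
  refine contMDiff_H ?_
  exact ((G.smooth_one.comp contMDiff_fst).mul (G.smooth_incl.comp contMDiff_snd)).mul
    (G.smooth_one.comp contMDiff_fst.inv)

theorem smooth_hPart : Mfd.Smooth G.hPart := by
  refine contMDiff_H ?_
  exact contMDiff_id.mul (G.smooth_one.comp G.src_sub.smooth.inv)

end LieTwoGroup


/-! ### Principal bundles -/

/-- A principal `G`-bundle `π : E → X` with right action `act` of the Lie group `G`: a smooth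
action along the fibres of `π` that is locally trivial. -/
structure IsPrincipalBundle {E X : Mfd.{u}} (G : Mfd.{u}) [Group G] [LieGroup G.I ∞ G]
    (π : E → X) (act : E → G → E) : Prop where
  smooth_proj : Mfd.Smooth π
  smooth_act : ContMDiff (E.I.prod G.I) E.I ∞ fun z : E × G => act z.1 z.2
  act_one (p : E) : act p 1 = p
  act_mul (p : E) (g h : G) : act p (g * h) = act (act p g) h
  proj_act (p : E) (g : G) : π (act p g) = π p
  locallyTrivial (x : X) : ∃ (U : Set X) (φ : OpenPartialHomeomorph E (X × G)),
    IsOpen U ∧ x ∈ U ∧ φ.source = π ⁻¹' U ∧ φ.target = U ×ˢ univ ∧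
    ContMDiffOn E.I (X.I.prod G.I) ∞ φ φ.source ∧
    ContMDiffOn (X.I.prod G.I) E.I ∞ φ.symm φ.target ∧
    ∀ p ∈ φ.source, (φ p).1 = π p ∧ ∀ g, (φ (act p g)).2 = (φ p).2 * g

/-- A principal `G`-bundle over a Lie groupoid `X`: a principal `G`-bundle over the objects with
an action of the arrows of `X` on its total space that commutes with the action of `G`. -/
structure PrincipalBundleOver (X : LieGroupoid.{u}) (G : Mfd.{u}) [Group G] [LieGroup G.I ∞ G] :
    Type (u + 1) where
  E : Mfd.{u}
  proj : E → X.Ob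
  act : E → G → E
  isPrincipal : IsPrincipalBundle G proj act
  μ (γ : X.Mor) (p : E) (h : X.src γ = proj p) : E
  smooth_μ : Mfd.Smooth fun x : Mfd.fiberProd X.src X.src_sub proj isPrincipal.smooth_proj =>
    μ (Mfd.fiberProd.fst x) (Mfd.fiberProd.snd x) (Mfd.fiberProd.condition x)
  μ_one (p : E) : μ (X.one (proj p)) p (X.src_one _) = p
  proj_μ (γ : X.Mor) (p : E) (h : X.src γ = proj p) : proj (μ γ p h) = X.tgt γ
  μ_comp (γ₂ γ₁ : X.Mor) (h : X.src γ₂ = X.tgt γ₁) (p : E) (h₁ : X.src γ₁ = proj p) :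
    μ (X.comp γ₂ γ₁ h) p ((X.src_comp _ _ _).trans h₁) =
      μ γ₂ (μ γ₁ p h₁) (h.trans (proj_μ γ₁ p h₁).symm)
  μ_act (γ : X.Mor) (p : E) (h : X.src γ = proj p) (g : G) :
    μ γ (act p g) (h.trans (isPrincipal.proj_act p g).symm) = act (μ γ p h) g

namespace PrincipalBundleOver

variable {X : LieGroupoid.{u}} {G : Mfd.{u}} [Group G] [LieGroup G.I ∞ G]
  (B : PrincipalBundleOver X G)

/-- The pullback `s^*E = X₁ ×_{s, X₀, π} E`. -/
abbrev pullback : Mfd.{u} := Mfd.fiberProd X.src X.src_sub B.proj B.isPrincipal.smooth_proj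

theorem μ_congr {γ γ' : X.Mor} {p p' : B.E} (hγ : γ = γ') (hp : p = p')
    (h : X.src γ = B.proj p) : B.μ γ p h = B.μ γ' p' (hγ ▸ hp ▸ h) := by
  subst hγ hp; rfl

end PrincipalBundleOver

/-- A principal `G`-bundle over a Lie groupoid `X`, for a Lie 2-group `G`: a functor `E → X` and
an action functor `E × G → E` that are principal bundles on objects and on morphisms. -/
structure PrincipalTwoBundle (G : LieTwoGroup.{u}) (X : LieGroupoid.{u}) : Type (u + 1) extends
    LieGroupoid.{u} where
  proj : LieGroupoid.Hom toLieGroupoid X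
  actOb : Ob → G.Ob → Ob
  actMor : Mor → G.Mor → Mor
  principalOb : IsPrincipalBundle G.Ob proj.ob actOb
  principalMor : IsPrincipalBundle G.Mor proj.mor actMor
  src_act (e : Mor) (k : G.Mor) : src (actMor e k) = actOb (src e) (G.src k)
  tgt_act (e : Mor) (k : G.Mor) : tgt (actMor e k) = actOb (tgt e) (G.tgt k)
  one_act (p : Ob) (g : G.Ob) : one (actOb p g) = actMor (one p) (G.one g)
  comp_act (e₂ e₁ : Mor) (k₂ k₁ : G.Mor) (he : src e₂ = tgt e₁) (hk : G.src k₂ = G.tgt k₁) :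
    comp (actMor e₂ k₂) (actMor e₁ k₁) (by rw [src_act, tgt_act, he, hk]) =
      actMor (comp e₂ e₁ he) (G.comp k₂ k₁ hk)

namespace PrincipalTwoBundle

variable {G : LieTwoGroup.{u}} {X : LieGroupoid.{u}}

/-- An isomorphism of principal 2-bundles over `X` with structure 2-group `G`: an isomorphism of
Lie groupoids that is `G`-equivariant and lies over the identity of `X`. -/
structure Iso (P Q : PrincipalTwoBundle G X) where
  ob : Diffeomorph P.Ob.I Q.Ob.I P.Ob Q.Ob ∞
  mor : Diffeomorph P.Mor.I Q.Mor.I P.Mor Q.Mor ∞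
  src_mor (e : P.Mor) : Q.src (mor e) = ob (P.src e)
  tgt_mor (e : P.Mor) : Q.tgt (mor e) = ob (P.tgt e)
  mor_one (p : P.Ob) : mor (P.one p) = Q.one (ob p)
  mor_comp (e₂ e₁ : P.Mor) (h : P.src e₂ = P.tgt e₁) :
    mor (P.comp e₂ e₁ h) = Q.comp (mor e₂) (mor e₁) (by rw [src_mor, tgt_mor, h])
  proj_ob (p : P.Ob) : Q.proj.ob (ob p) = P.proj.ob p
  proj_mor (e : P.Mor) : Q.proj.mor (mor e) = P.proj.mor e
  ob_act (p : P.Ob) (g : G.Ob) : ob (P.actOb p g) = Q.actOb (ob p) g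
  mor_act (e : P.Mor) (k : G.Mor) : mor (P.actMor e k) = Q.actMor (mor e) k

/-- The pullback `s^*E₀ = X₁ ×_{s, X₀, π₀} E₀`. -/
abbrev pullback (P : PrincipalTwoBundle G X) : Mfd.{u} :=
  Mfd.fiberProd X.src X.src_sub P.proj.ob P.principalOb.smooth_proj

end PrincipalTwoBundle

/-! ### Decorated bundles -/

namespace Decorated

variable {G : LieTwoGroup.{u}} {X : LieGroupoid.{u}} (B : PrincipalBundleOver X G.Ob)

/-- The manifold `s^*E × H` of arrows of the decorated bundle. -/
@[reducible]
def Mor : Mfd.{u} := B.pullback.prod G.H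

variable {B}

/-- The arrow `(γ, p, h)`. -/
def mk (γ : X.Mor) (p : B.E) (hγ : X.src γ = B.proj p) (h : G.H) : Mor B :=
  (Mfd.fiberProd.mk γ p hγ, h)

/-- The component `γ` of `(γ, p, h)`. -/
def arrow (e : Mor B) : X.Mor := Mfd.fiberProd.fst e.1

/-- The component `p` of `(γ, p, h)`, which is its source. -/
def src (e : Mor B) : B.E := Mfd.fiberProd.snd e.1

theorem src_arrow (e : Mor B) : X.src (arrow e) = B.proj (src e) := Mfd.fiberProd.condition e.1

theorem ext {e e' : Mor B} (h₁ : arrow e = arrow e') (h₂ : src e = src e')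
    (h₃ : e.2 = e'.2) : e = e' :=
  Prod.ext (Mfd.fiberProd.ext h₁ h₂) h₃

theorem smooth_arrow : Mfd.Smooth (arrow : Mor B → X.Mor) :=
  Mfd.fiberProd.smooth_fst.comp contMDiff_fst

theorem smooth_src : Mfd.Smooth (src : Mor B → B.E) :=
  Mfd.fiberProd.smooth_snd.comp contMDiff_fst

theorem smooth_dec : Mfd.Smooth (fun e : Mor B => e.2) := contMDiff_snd

theorem contMDiffOn_lift {EQ HQ Q : Type*} [NormedAddCommGroup EQ] [NormedSpace ℝ EQ]
    [TopologicalSpace HQ] [TopologicalSpace Q] [ChartedSpace HQ Q] {I' : ModelWithCorners ℝ EQ HQ}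
    {f : Q → Mor B} {s : Set Q} (h₁ : ContMDiffOn I' X.Mor.I ∞ (fun z => arrow (f z)) s)
    (h₂ : ContMDiffOn I' B.E.I ∞ (fun z => src (f z)) s)
    (h₃ : ContMDiffOn I' G.H.I ∞ (fun z => (f z).2) s) : ContMDiffOn I' (Mor B).I ∞ f s :=
  (Mfd.fiberProd.contMDiffOn_lift h₁ h₂ :
    ContMDiffOn I' B.pullback.I ∞ (fun z => (f z).1) s).prodMk h₃

theorem contMDiff_lift {EQ HQ Q : Type*} [NormedAddCommGroup EQ] [NormedSpace ℝ EQ]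
    [TopologicalSpace HQ] [TopologicalSpace Q] [ChartedSpace HQ Q] {I' : ModelWithCorners ℝ EQ HQ}
    {f : Q → Mor B} (h₁ : ContMDiff I' X.Mor.I ∞ fun z => arrow (f z))
    (h₂ : ContMDiff I' B.E.I ∞ fun z => src (f z))
    (h₃ : ContMDiff I' G.H.I ∞ fun z => (f z).2) : ContMDiff I' (Mor B).I ∞ f :=
  contMDiffOn_univ.1 (contMDiffOn_lift h₁.contMDiffOn h₂.contMDiffOn h₃.contMDiffOn)

/-- The target `μ(γ, p) τ(h⁻¹)` of `(γ, p, h)`. -/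
def tgt (e : Mor B) : B.E := B.act (B.μ (arrow e) (src e) (src_arrow e)) (G.τ e.2⁻¹)

theorem proj_tgt (e : Mor B) : B.proj (tgt e) = X.tgt (arrow e) :=
  (B.isPrincipal.proj_act _ _).trans (B.proj_μ _ _ _)

theorem smooth_tgt : Mfd.Smooth (tgt : Mor B → B.E) :=
  B.isPrincipal.smooth_act.comp ((B.smooth_μ.comp contMDiff_fst).prodMk
    (G.smooth_τ.comp contMDiff_snd.inv))

/-- The unit `p ↦ (1_{π(p)}, p, e)`. -/
def one (p : B.E) : Mor B := mk (X.one (B.proj p)) p (X.src_one _) 1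

/-- The inverse `(γ, p, h) ↦ (γ⁻¹, μ(γ, p) τ(h⁻¹), h⁻¹)`. -/
def inv (e : Mor B) : Mor B :=
  mk (X.inv (arrow e)) (tgt e) ((X.src_inv _).trans (proj_tgt e).symm) e.2⁻¹

/-- The composition `(γ₂, p₂, h₂) ∘ (γ₁, p₁, h₁) = (γ₂ ∘ γ₁, p₁, h₂ h₁)`. -/
def comp (e₂ e₁ : Mor B) (h : src e₂ = tgt e₁) : Mor B :=
  mk (X.comp (arrow e₂) (arrow e₁) ((src_arrow e₂).trans ((congrArg B.proj h).trans (proj_tgt e₁))))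
    (src e₁) ((X.src_comp _ _ _).trans (src_arrow e₁)) (e₂.2 * e₁.2)

theorem tgt_mk (γ : X.Mor) (p : B.E) (hγ : X.src γ = B.proj p) (h : G.H) :
    tgt (mk γ p hγ h) = B.act (B.μ γ p hγ) (G.τ h⁻¹) := rfl

theorem tgt_one (p : B.E) : tgt (one p) = p := by
  change B.act (B.μ (X.one (B.proj p)) p _) (G.τ 1⁻¹) = p
  rw [B.μ_one, _root_.inv_one, map_one, B.isPrincipal.act_one]

theorem tgt_comp (e₂ e₁ : Mor B) (h : src e₂ = tgt e₁) : tgt (comp e₂ e₁ h) = tgt e₂ := by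
  have h0 : X.src (arrow e₂) = X.tgt (arrow e₁) :=
    (src_arrow e₂).trans ((congrArg B.proj h).trans (proj_tgt e₁))
  have e : B.μ (arrow e₂) (src e₂) (src_arrow e₂) =
      B.act (B.μ (X.comp (arrow e₂) (arrow e₁) h0) (src e₁)
        ((X.src_comp _ _ _).trans (src_arrow e₁))) (G.τ e₁.2⁻¹) := by
    rw [B.μ_comp, ← B.μ_act]
    exact B.μ_congr rfl h _
  change B.act (B.μ (X.comp _ _ _) (src e₁) _) (G.τ (e₂.2 * e₁.2)⁻¹) =
    B.act (B.μ (arrow e₂) (src e₂) _) (G.τ e₂.2⁻¹)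
  rw [e, ← B.isPrincipal.act_mul, ← map_mul, mul_inv_rev]

theorem tgt_inv (e : Mor B) : tgt (inv e) = src e := by
  have h0 : B.μ (X.inv (arrow e)) (B.μ (arrow e) (src e) (src_arrow e))
      ((X.src_inv _).trans (B.proj_μ _ _ _).symm) = src e := by
    rw [← B.μ_comp (X.inv (arrow e)) (arrow e) (X.src_inv _) (src e) (src_arrow e)]
    rw [B.μ_congr ((X.inv_comp (arrow e)).trans (congrArg X.one (src_arrow e))) rfl, B.μ_one]
  change B.act (B.μ (X.inv (arrow e)) (B.act _ (G.τ e.2⁻¹)) _) (G.τ e.2⁻¹⁻¹) = src e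
  rw [B.μ_act _ _ ((X.src_inv _).trans (B.proj_μ _ _ _).symm), h0, ← B.isPrincipal.act_mul,
    ← map_mul, mul_inv_cancel, map_one, B.isPrincipal.act_one]

theorem inv_inv (e : Mor B) : inv (inv e) = e :=
  ext (X.inv_inv (arrow e)) (tgt_inv e) (_root_.inv_inv e.2)

theorem smooth_inv : Mfd.Smooth (inv : Mor B → Mor B) :=
  contMDiff_lift (X.smooth_inv.comp smooth_arrow) smooth_tgt smooth_dec.inv

/-- Inversion as a diffeomorphism. -/
def invDiffeomorph : Diffeomorph (Mor B).I (Mor B).I (Mor B) (Mor B) ∞ where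
  toFun := inv
  invFun := inv
  left_inv := inv_inv
  right_inv := inv_inv
  contMDiff_toFun := smooth_inv
  contMDiff_invFun := smooth_inv

theorem src_sub : Mfd.SurjSubmersion (src : Mor B → B.E) where
  submersion := Manifold.IsSubmersion.comp_fst (M := B.pullback) (I := B.pullback.I)
    (Mfd.fiberProd.surjSubmersion_snd (f := X.src) (hf := X.src_sub)).submersion
  surjective p := ⟨one p, rfl⟩

theorem tgt_sub : Mfd.SurjSubmersion (tgt : Mor B → B.E) where
  submersion := Manifold.IsSubmersion.comp_diffeomorph (src_sub (B := B)).submersion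
    (invDiffeomorph (B := B))
  surjective p := ⟨one p, tgt_one p⟩

theorem smooth_comp : Mfd.Smooth fun x : Mfd.fiberProd (src : Mor B → B.E) src_sub tgt
    tgt_sub.smooth =>
    comp (Mfd.fiberProd.fst x) (Mfd.fiberProd.snd x) (Mfd.fiberProd.condition x) := by
  have h₁ : Mfd.Smooth (Mfd.fiberProd.fst : Mfd.fiberProd (src : Mor B → B.E) src_sub tgt
    tgt_sub.smooth → Mor B) := Mfd.fiberProd.smooth_fst
  have h₂ : Mfd.Smooth (Mfd.fiberProd.snd : Mfd.fiberProd (src : Mor B → B.E) src_sub tgt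
    tgt_sub.smooth → Mor B) := Mfd.fiberProd.smooth_snd
  refine contMDiff_lift ?_ ?_ ?_
  · exact LieGroupoid.contMDiff_comp (smooth_arrow.comp h₁ :) (smooth_arrow.comp h₂ :) fun x =>
      (src_arrow _).trans ((congrArg B.proj (Mfd.fiberProd.condition x)).trans (proj_tgt _))
  · exact (smooth_src.comp h₂ :)
  · exact (smooth_dec.comp h₁).mul (smooth_dec.comp h₂)

variable (B) in
/-- The Lie groupoid `[s^*E × H ⇉ E]`. -/
def groupoid : LieGroupoid.{u} where
  Ob := B.E
  Mor := Mor B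
  src := src
  tgt := tgt
  src_sub := src_sub
  tgt_sub := tgt_sub
  one := one
  inv := inv
  comp := comp
  src_one _ := rfl
  tgt_one := tgt_one
  src_inv _ := rfl
  tgt_inv := tgt_inv
  src_comp _ _ _ := rfl
  tgt_comp := tgt_comp
  comp_assoc e₃ e₂ e₁ _ _ := ext (X.comp_assoc _ _ _ _ _) rfl (mul_assoc e₃.2 e₂.2 e₁.2)
  comp_one e := ext
    ((LieGroupoid.comp_congr rfl (congrArg X.one (src_arrow e).symm) _).trans (X.comp_one _))
    rfl (mul_one e.2)
  one_comp e := ext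
    ((LieGroupoid.comp_congr (congrArg X.one (proj_tgt e)) rfl _).trans (X.one_comp _))
    rfl (one_mul e.2)
  comp_inv e := ext ((X.comp_inv (arrow e)).trans (congrArg X.one (proj_tgt e).symm)) rfl
    (mul_inv_cancel e.2)
  inv_comp e := ext ((X.inv_comp (arrow e)).trans (congrArg X.one (src_arrow e))) rfl
    (inv_mul_cancel e.2)
  smooth_one := contMDiff_lift (X.smooth_one.comp B.isPrincipal.smooth_proj) contMDiff_id
    contMDiff_const
  smooth_inv := smooth_inv
  smooth_comp := smooth_comp

variable (B) in
/-- The projection functor, `p ↦ π(p)` and `(γ, p, h) ↦ γ`. -/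
def proj : LieGroupoid.Hom (groupoid B) X where
  ob := B.proj
  mor := arrow
  smooth_ob := B.isPrincipal.smooth_proj
  smooth_mor := smooth_arrow
  src_mor := src_arrow
  tgt_mor e := (proj_tgt e).symm
  mor_one _ := rfl
  mor_comp _ _ _ := rfl

/-- The action of `k = (h', g) ∈ G₁ = H ⋊ G₀` on arrows,
`(γ, p, h) (h', g) = (γ, p g, α(g⁻¹, h'⁻¹ h))`. -/
def act (e : Mor B) (k : G.Mor) : Mor B :=
  mk (arrow e) (B.act (src e) (G.src k))
    ((src_arrow e).trans (B.isPrincipal.proj_act _ _).symm)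
    (G.α (G.src k)⁻¹ ((G.hPart k)⁻¹ * e.2))

theorem incl_act (e : Mor B) (k : G.Mor) :
    G.incl (act e k).2 = k⁻¹ * G.incl e.2 * G.one (G.src k) := G.incl_act k e.2

theorem tgt_act (e : Mor B) (k : G.Mor) : tgt (act e k) = B.act (tgt e) (G.tgt k) := by
  have h1 : G.τ (act e k).2⁻¹ = (G.src k)⁻¹ * (G.τ e.2⁻¹ * G.tgt k) := by
    rw [G.τ_apply, G.τ_apply, G.incl_inv, incl_act, G.incl_inv, G.tgt_inv', G.tgt_mul, G.tgt_mul,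
      G.tgt_inv', G.tgt_inv', G.tgt_one]
    group
  change B.act (B.μ (arrow e) (B.act (src e) (G.src k)) _) (G.τ (act e k).2⁻¹) =
    B.act (B.act (B.μ (arrow e) (src e) (src_arrow e)) (G.τ e.2⁻¹)) (G.tgt k)
  rw [h1, B.μ_act _ _ (src_arrow e), ← B.isPrincipal.act_mul, ← B.isPrincipal.act_mul,
    mul_inv_cancel_left]

theorem one_act (p : B.E) (g : G.Ob) : one (B.act p g) = act (one p) (G.one g) := by
  refine ext (congrArg X.one (B.isPrincipal.proj_act p g)) ?_ (LieTwoGroup.H_ext ?_)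
  · change B.act p g = B.act p (G.src (G.one g))
    rw [G.src_one]
  · rw [incl_act, G.src_one]
    change (1 : G.Mor) = (G.one g)⁻¹ * 1 * G.one g
    group

theorem comp_act (e₂ e₁ : Mor B) (k₂ k₁ : G.Mor) (he : src e₂ = tgt e₁)
    (hk : G.src k₂ = G.tgt k₁) (h : src (act e₂ k₂) = tgt (act e₁ k₁)) :
    comp (act e₂ k₂) (act e₁ k₁) h = act (comp e₂ e₁ he) (G.comp k₂ k₁ hk) := by
  refine ext rfl ?_ (LieTwoGroup.H_ext ?_)
  · change B.act (src e₁) (G.src k₁) = B.act (src e₁) (G.src (G.comp k₂ k₁ hk))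
    rw [G.src_comp]
  · rw [incl_act]
    change G.incl (act e₂ k₂).2 * G.incl (act e₁ k₁).2 =
      (G.comp k₂ k₁ hk)⁻¹ * (G.incl e₂.2 * G.incl e₁.2) * G.one (G.src (G.comp k₂ k₁ hk))
    rw [incl_act, incl_act, G.src_comp, G.comp_eq]
    have hc := G.commute_ker (a := k₂⁻¹ * G.incl e₂.2 * G.one (G.src k₂))
      (b := k₁⁻¹ * G.one (G.src k₂))
      (by rw [G.src_mul, G.src_mul, G.src_inv', G.src_incl, G.src_one, mul_one, inv_mul_cancel])
      (by rw [G.tgt_mul, G.tgt_inv', G.tgt_one, hk, inv_mul_cancel])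
    calc k₂⁻¹ * G.incl e₂.2 * G.one (G.src k₂) * (k₁⁻¹ * G.incl e₁.2 * G.one (G.src k₁))
        = (k₂⁻¹ * G.incl e₂.2 * G.one (G.src k₂)) * (k₁⁻¹ * G.one (G.src k₂)) *
          ((G.one (G.src k₂))⁻¹ * G.incl e₁.2 * G.one (G.src k₁)) := by group
      _ = _ := by rw [hc]; group

theorem isPrincipalBundle : IsPrincipalBundle (E := Mor B) (X := X.Mor) G.Mor arrow act where
  smooth_proj := smooth_arrow
  smooth_act := by
    have h₁ : ContMDiff ((Mor B).I.prod G.Mor.I) (Mor B).I ∞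
        (Prod.fst : Mor B × G.Mor → Mor B) := contMDiff_fst
    have h₂ : ContMDiff ((Mor B).I.prod G.Mor.I) G.Mor.I ∞
        (Prod.snd : Mor B × G.Mor → G.Mor) := contMDiff_snd
    have h₃ := G.src_sub.smooth.comp h₂
    refine contMDiff_lift (smooth_arrow.comp h₁ :) ?_ (LieTwoGroup.contMDiff_H ?_)
    · exact B.isPrincipal.smooth_act.comp ((smooth_src.comp h₁).prodMk h₃)
    · refine ContMDiff.congr ?_ fun z => incl_act z.1 z.2
      exact (h₂.inv.mul (G.smooth_incl.comp (smooth_dec.comp h₁))).mul (G.smooth_one.comp h₃)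
  act_one e := by
    refine ext rfl ?_ (LieTwoGroup.H_ext ?_)
    · change B.act (src e) (G.src 1) = src e
      rw [G.src_one', B.isPrincipal.act_one]
    · rw [incl_act, G.src_one', G.one_one, _root_.inv_one, _root_.one_mul, _root_.mul_one]
  act_mul e k l := by
    refine ext rfl ?_ (LieTwoGroup.H_ext ?_)
    · change B.act (src e) (G.src (k * l)) = B.act (B.act (src e) (G.src k)) (G.src l)
      rw [G.src_mul, B.isPrincipal.act_mul]
    · rw [incl_act, incl_act, incl_act, G.src_mul, G.one_mul]
      group
  proj_act _ _ := rfl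
  locallyTrivial γ := by
    obtain ⟨U, φ, hU, hx, hs, ht, hφ, hφ', he⟩ := B.isPrincipal.locallyTrivial (X.src γ)
    have hV : IsOpen (X.src ⁻¹' U) := hU.preimage X.src_sub.smooth.continuous
    have hmem : ∀ q ∈ (X.src ⁻¹' U) ×ˢ (univ : Set G.Mor),
        ((X.src q.1, G.src q.2) : X.Ob × G.Ob) ∈ φ.target := by
      intro q hq; rw [ht]; exact ⟨hq.1, mem_univ _⟩
    have hproj : ∀ q ∈ (X.src ⁻¹' U) ×ˢ (univ : Set G.Mor),
        X.src q.1 = B.proj (φ.symm (X.src q.1, G.src q.2)) := by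
      intro q hq
      have h1 := (he _ (φ.map_target (hmem q hq))).1
      rw [φ.right_inv (hmem q hq)] at h1
      exact h1
    have hmem' : ∀ e : Mor B, X.src (arrow e) ∈ U → src e ∈ φ.source := by
      intro e h
      rw [hs]; change B.proj (src e) ∈ U; rwa [← src_arrow]
    have hfst : ∀ e : Mor B, X.src (arrow e) ∈ U →
        φ (src e) = (X.src (arrow e), (φ (src e)).2) := fun e h =>
      Prod.ext ((he _ (hmem' e h)).1.trans (src_arrow e).symm) rfl
    classical
    let f : Mor B → X.Mor × G.Mor := fun e =>
      (arrow e, G.one (φ (src e)).2 * (G.incl e.2)⁻¹)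
    let g : X.Mor × G.Mor → Mor B := fun q =>
      if h : q ∈ (X.src ⁻¹' U) ×ˢ (univ : Set G.Mor) then
        mk q.1 (φ.symm (X.src q.1, G.src q.2)) (hproj q h)
          (G.toH (q.2⁻¹ * G.one (G.src q.2)) (by
            rw [G.src_mul, G.src_inv', G.src_one, inv_mul_cancel]))
      else mk γ (φ.symm (X.src γ, 1))
        (hproj (γ, 1) ⟨hx, mem_univ _⟩ |>.trans (by rw [G.src_one'])) 1
    have hg1 : ∀ q ∈ (X.src ⁻¹' U) ×ˢ (univ : Set G.Mor), arrow (g q) = q.1 := by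
      intro q hq; simp only [g, dif_pos hq]; rfl
    have hg2 : ∀ q ∈ (X.src ⁻¹' U) ×ˢ (univ : Set G.Mor),
        src (g q) = φ.symm (X.src q.1, G.src q.2) := by
      intro q hq; simp only [g, dif_pos hq]; rfl
    have hg3 : ∀ q ∈ (X.src ⁻¹' U) ×ˢ (univ : Set G.Mor),
        G.incl (g q).2 = q.2⁻¹ * G.one (G.src q.2) := by
      intro q hq; simp only [g, dif_pos hq]; rfl
    have hf : ContMDiffOn (Mor B).I (X.Mor.I.prod G.Mor.I) ∞ f (arrow ⁻¹' (X.src ⁻¹' U)) := by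
      refine smooth_arrow.contMDiffOn.prodMk (ContMDiffOn.mul ?_ ?_)
      · refine G.smooth_one.comp_contMDiffOn (contMDiff_snd.comp_contMDiffOn
          (hφ.comp smooth_src.contMDiffOn hmem'))
      · exact (G.smooth_incl.comp smooth_dec).inv.contMDiffOn
    have hsrcf : ∀ e : Mor B, G.src (f e).2 = (φ (src e)).2 := by
      intro e
      change G.src (_ * _) = _
      rw [G.src_mul, G.src_one, G.src_inv', G.src_incl, _root_.inv_one, mul_one]
    have hg : ContMDiffOn (X.Mor.I.prod G.Mor.I) (Mor B).I ∞ g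
        ((X.src ⁻¹' U) ×ˢ (univ : Set G.Mor)) := by
      refine contMDiffOn_lift (contMDiff_fst.contMDiffOn.congr hg1) (ContMDiffOn.congr ?_ hg2)
        (LieTwoGroup.contMDiffOn_H (ContMDiffOn.congr ?_ hg3))
      · exact hφ'.comp (((X.src_sub.smooth.comp contMDiff_fst).prodMk
          (G.src_sub.smooth.comp contMDiff_snd)).contMDiffOn) hmem
      · exact (contMDiff_snd.inv.mul (G.smooth_one.comp
          (G.src_sub.smooth.comp contMDiff_snd))).contMDiffOn
    refine ⟨X.src ⁻¹' U,
      { toFun := f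
        invFun := g
        source := arrow ⁻¹' (X.src ⁻¹' U)
        target := (X.src ⁻¹' U) ×ˢ univ
        map_source' := fun e h => ⟨h, mem_univ _⟩
        map_target' := fun q hq => by
          change X.src (arrow (g q)) ∈ U
          rw [hg1 q hq]; exact hq.1
        left_inv' := fun e h => by
          have hq : f e ∈ (X.src ⁻¹' U) ×ˢ (univ : Set G.Mor) := ⟨h, mem_univ _⟩
          refine ext (hg1 _ hq) ?_ (LieTwoGroup.H_ext ?_)
          · rw [hg2 _ hq, hsrcf]
            change φ.symm (X.src (arrow e), (φ (src e)).2) = src e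
            rw [← hfst e h, φ.left_inv (hmem' e h)]
          · rw [hg3 _ hq, hsrcf]
            change (G.one (φ (src e)).2 * (G.incl e.2)⁻¹)⁻¹ * G.one (φ (src e)).2 = _
            group
        right_inv' := fun q hq => by
          refine Prod.ext (hg1 q hq) ?_
          change G.one (φ (src (g q))).2 * (G.incl (g q).2)⁻¹ = q.2
          rw [hg2 q hq, hg3 q hq, φ.right_inv (hmem q hq)]
          group
        open_source := hV.preimage smooth_arrow.continuous
        open_target := hV.prod isOpen_univ
        continuousOn_toFun := hf.continuousOn
        continuousOn_invFun := hg.continuousOn }, hV, hx, rfl, rfl, hf, hg, ?_⟩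
    intro e h
    refine ⟨rfl, fun k => ?_⟩
    change G.one (φ (B.act (src e) (G.src k))).2 * (G.incl (act e k).2)⁻¹ =
      G.one (φ (src e)).2 * (G.incl e.2)⁻¹ * k
    rw [(he _ (hmem' e h)).2, G.one_mul, incl_act]
    group

variable (B) in
/-- The decorated principal 2-bundle `[s^*E × H ⇉ E]` of a principal `G₀`-bundle over `X`. -/
def bundle : PrincipalTwoBundle G X where
  toLieGroupoid := groupoid B
  proj := proj B
  actOb := B.act
  actMor := act
  principalOb := B.isPrincipal
  principalMor := isPrincipalBundle
  src_act _ _ := rfl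
  tgt_act := tgt_act
  one_act := one_act
  comp_act e₂ e₁ k₂ k₁ he hk := comp_act e₂ e₁ k₂ k₁ he hk
    ((congrArg₂ B.act he hk).trans (tgt_act e₁ k₁).symm)

end Decorated

/-! ### Categorical connections -/

/-- A categorical connection on a principal 2-bundle: an embedding `s^*E₀ → E₁`,
`(γ, p) ↦ lift γ p`, that is horizontal, functorial and equivariant. -/
structure CategoricalConnection {G : LieTwoGroup.{u}} {X : LieGroupoid.{u}}
    (P : PrincipalTwoBundle G X) where
  lift (γ : X.Mor) (p : P.Ob) (h : X.src γ = P.proj.ob p) : P.Mor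
  isSmoothEmbedding : Manifold.IsSmoothEmbedding P.pullback.I P.Mor.I ∞ fun x : P.pullback =>
    lift (Mfd.fiberProd.fst x) (Mfd.fiberProd.snd x) (Mfd.fiberProd.condition x)
  src_lift (γ : X.Mor) (p : P.Ob) (h : X.src γ = P.proj.ob p) : P.src (lift γ p h) = p
  proj_lift (γ : X.Mor) (p : P.Ob) (h : X.src γ = P.proj.ob p) : P.proj.mor (lift γ p h) = γ
  lift_comp (γ₂ γ₁ : X.Mor) (p₂ p₁ : P.Ob) (h₂ : X.src γ₂ = P.proj.ob p₂)
    (h₁ : X.src γ₁ = P.proj.ob p₁) (h : X.src γ₂ = X.tgt γ₁) (hp : p₂ = P.tgt (lift γ₁ p₁ h₁)) :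
    lift (X.comp γ₂ γ₁ h) p₁ ((X.src_comp _ _ _).trans h₁) =
      P.comp (lift γ₂ p₂ h₂) (lift γ₁ p₁ h₁) ((src_lift _ _ _).trans hp)
  lift_one (x : X.Ob) (p : P.Ob) (h : P.proj.ob p = x) :
    lift (X.one x) p ((X.src_one x).trans h.symm) = P.one p
  lift_act (γ : X.Mor) (p : P.Ob) (h : X.src γ = P.proj.ob p) (g : G.Ob) :
    lift γ (P.actOb p g) (h.trans (P.principalOb.proj_act p g).symm) =
      P.actMor (lift γ p h) (G.one g)

namespace CategoricalConnection

variable {G : LieTwoGroup.{u}} {X : LieGroupoid.{u}} {P : PrincipalTwoBundle G X}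
  (C : CategoricalConnection P)

theorem proj_tgt_lift (γ : X.Mor) (p : P.Ob) (h : X.src γ = P.proj.ob p) :
    P.proj.ob (P.tgt (C.lift γ p h)) = X.tgt γ := by
  rw [← P.proj.tgt_mor, C.proj_lift]

/-- The principal `G₀`-bundle `E₀ → X₀` over `X` with action `μ(γ, p) = t(C(γ, p))`. -/
def bundleOver : PrincipalBundleOver X G.Ob where
  E := P.Ob
  proj := P.proj.ob
  act := P.actOb
  isPrincipal := P.principalOb
  μ γ p h := P.tgt (C.lift γ p h)
  smooth_μ := P.tgt_sub.smooth.comp C.isSmoothEmbedding.contMDiff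
  μ_one p := (congrArg P.tgt (C.lift_one _ p rfl)).trans (P.tgt_one p)
  proj_μ := C.proj_tgt_lift
  μ_comp γ₂ γ₁ h p h₁ :=
    (congrArg P.tgt (C.lift_comp γ₂ γ₁ _ p (h.trans (C.proj_tgt_lift γ₁ p h₁).symm) h₁ h rfl)).trans
      (P.tgt_comp _ _ _)
  μ_act γ p h g := by
    rw [C.lift_act γ p h, P.tgt_act, G.tgt_one]

end CategoricalConnection

end

/-! A categorical connection picks, over each arrow `γ` of `X` and each point `p` over its source,
one arrow `C(γ, p)` of `P`. Any other arrow `e` over `γ` lies in the same `G₁`-orbit, so `e = C(γ,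
p) k` for exactly one `k`. If `e` also starts at `p`, then `p (src k) = p`, and freeness of the
action on objects forces `src k = 1`. Hence `k` lies in `H`, and the arrows of `P` are parametrised
by `s^*E₀ × H`. This is the map `θ`. Its inverse is smooth because, in a local trivialisation of a
principal bundle, the element carrying one point of a fibre to another is a quotient of group
coordinates (`IsPrincipalBundle.contMDiff_of_act`).

What remains is that `θ` respects the structure maps. Sources, targets, units and the action follow
from the axioms of a connection and the equivariance of `P`. Composition is the substantial point
(`decMor_comp`): the second arrow starts at a point moved by `τ(h₁⁻¹)`, equivariance of `C` turns
this into a factor `1_{τ(h₁⁻¹)}`, the interchange law reduces the claim to a composite in `G₁`, and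
the Peiffer identity (`one_τ_mul`) evaluates that composite as `h₁⁻¹ h₂⁻¹ = (h₂ h₁)⁻¹`.

Conversely, a decorated bundle has the evident connection `(γ, p) ↦ (γ, p, e)`, and an isomorphism
carries it to `P`. It is an embedding because it is a slice of a product decomposition `s^*E₀ × H ≅
P.Mor` (`Manifold.isSmoothEmbedding_slice`). -/

noncomputable section

/-! ### Torsor structure of the fibres of a principal bundle -/

namespace IsPrincipalBundle

variable {E X : Mfd.{u}} {G : Mfd.{u}} [Group G] [LieGroup G.I ∞ G] {π : E → X} {act : E → G → E}

/-- The group acts transitively on the fibres of a principal bundle. -/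
theorem exists_act_eq (h : IsPrincipalBundle G π act) {p q : E} (hpq : π p = π q) :
    ∃ g, act p g = q := by
  obtain ⟨U, φ, -, hx, hs, -, -, -, he⟩ := h.locallyTrivial (π p)
  have hp : p ∈ φ.source := by rw [hs]; exact hx
  have hq : q ∈ φ.source := by rw [hs, mem_preimage, ← hpq]; exact hx
  have hpg : act p ((φ p).2⁻¹ * (φ q).2) ∈ φ.source := by
    rw [hs, mem_preimage, h.proj_act]; exact hx
  -- In the trivialisation the group acts by right multiplication on the second coordinate, so this
  -- quotient is the only candidate.
  refine ⟨(φ p).2⁻¹ * (φ q).2, φ.injOn hpg hq (Prod.ext ?_ ?_)⟩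
  · rw [(he _ hpg).1, (he _ hq).1, h.proj_act, hpq]
  · rw [(he _ hp).2, mul_inv_cancel_left]

/-- The group acts freely on a principal bundle. -/
theorem act_injective (h : IsPrincipalBundle G π act) (p : E) : Function.Injective (act p) := by
  intro g g' hg
  obtain ⟨U, φ, -, hx, hs, -, -, -, he⟩ := h.locallyTrivial (π p)
  have hp : p ∈ φ.source := by rw [hs]; exact hx
  have h1 := congrArg (fun q => (φ q).2) hg
  simp only [(he p hp).2] at h1
  exact mul_left_cancel h1

/-- The element of the group that takes one point of a fibre to another one depends smoothly on
the two points. -/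
theorem contMDiff_of_act (h : IsPrincipalBundle G π act) {EQ HQ Q : Type*}
    [NormedAddCommGroup EQ] [NormedSpace ℝ EQ] [TopologicalSpace HQ] [TopologicalSpace Q]
    [ChartedSpace HQ Q] {I' : ModelWithCorners ℝ EQ HQ} {p q : Q → E} {g : Q → G}
    (hp : ContMDiff I' E.I ∞ p) (hq : ContMDiff I' E.I ∞ q) (hg : ∀ z, act (p z) (g z) = q z) :
    ContMDiff I' G.I ∞ g := by
  intro z
  obtain ⟨U, φ, hU, hx, hs, -, hφ, -, he⟩ := h.locallyTrivial (π (p z))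
  have hO : IsOpen (p ⁻¹' φ.source) := φ.open_source.preimage hp.continuous
  have hz : z ∈ p ⁻¹' φ.source := by rw [hs]; exact hx
  have hpq : ∀ w ∈ p ⁻¹' φ.source, q w ∈ φ.source := by
    intro w hw
    rw [hs] at hw ⊢
    change π (q w) ∈ U
    rw [← hg, h.proj_act]
    exact hw
  -- Nothing is assumed about the regularity of `g`. Near `z` it agrees with this quotient of group
  -- coordinates, which is smooth.
  have h1 : ContMDiffOn I' G.I ∞ (fun w => (φ (p w)).2⁻¹ * (φ (q w)).2) (p ⁻¹' φ.source) :=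
    (contMDiff_snd.comp_contMDiffOn (hφ.comp hp.contMDiffOn fun _ hw => hw)).inv.mul
      (contMDiff_snd.comp_contMDiffOn (hφ.comp hq.contMDiffOn hpq))
  refine ((h1.congr fun w hw => ?_).contMDiffAt (hO.mem_nhds hz))
  rw [← hg w, (he _ hw).2, inv_mul_cancel_left]

end IsPrincipalBundle

/-! ### Slices of product decompositions -/

namespace Manifold

variable {EM HM M EN HN N EK HK K : Type*}
  [NormedAddCommGroup EM] [NormedSpace ℝ EM] [TopologicalSpace HM]
  [TopologicalSpace M] [ChartedSpace HM M] {I : ModelWithCorners ℝ EM HM} [I.Boundaryless]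
  [NormedAddCommGroup EN] [NormedSpace ℝ EN] [TopologicalSpace HN]
  [TopologicalSpace N] [ChartedSpace HN N] {J : ModelWithCorners ℝ EN HN} [J.Boundaryless]
  [NormedAddCommGroup EK] [NormedSpace ℝ EK] [TopologicalSpace HK]
  [TopologicalSpace K] [ChartedSpace HK K] {I' : ModelWithCorners ℝ EK HK} [I'.Boundaryless]
  [IsManifold I ∞ M] [IsManifold J ∞ N] [IsManifold I' ∞ K]

/-- A slice of a product decomposition of a manifold is an immersed submanifold. -/
theorem isImmersion_slice (Φ : Diffeomorph (I.prod I') J (M × K) N ∞) (c : K) :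
    IsImmersion I J ∞ fun x => Φ (x, c) := by
  refine IsImmersionOfComplement.isImmersion (F := EK) fun x => ?_
  -- Only some linear isomorphism between the model spaces is needed; the differential of `Φ`
  -- supplies one.
  let L : (EM × EK) ≃L[ℝ] EN :=
    Φ.mfderivToContinuousLinearEquiv (by simp) (x, c)
  -- Subtracting `v` moves the coordinate of `c` to the origin, so that the slice becomes the
  -- subspace where the second coordinate vanishes. Without boundary, the models with corners are
  -- homeomorphisms onto the full vector spaces, hence `A` is a globally defined change of model.
  let v : EM × EK := (0, I' (chartAt HK c c))
  let A : ModelProd HM HK ≃ₜ HN := (((I.prod I').toHomeomorph.trans (Homeomorph.subRight v)).trans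
    L.toHomeomorph).trans J.toHomeomorph.symm
  let e₀ : OpenPartialHomeomorph (M × K) (ModelProd HM HK) :=
    (chartAt HM x).prod (chartAt HK c)
  have he₀ : e₀ ∈ IsManifold.maximalAtlas (I.prod I') ∞ (M × K) :=
    IsManifold.mem_maximalAtlas_prod (IsManifold.chart_mem_maximalAtlas x)
      (IsManifold.chart_mem_maximalAtlas c)
  -- The chart of `N` adapted to the slice: undo `Φ`, take product coordinates centred at `c` in the
  -- second factor, and transport them to the model of `N`.
  let e : OpenPartialHomeomorph N HN :=
    Φ.symm.toHomeomorph.toOpenPartialHomeomorph ≫ₕ (e₀ ≫ₕ A.toOpenPartialHomeomorph)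
  have hsrc : e.source = Φ.symm ⁻¹' e₀.source := by
    simp [e]
  have htgt : e.target = A.symm ⁻¹' e₀.target := by
    simp [e]
  have hJ : ContMDiff 𝓘(ℝ, EN) J ∞ J.symm := by
    rw [← contMDiffOn_univ, ← J.range_eq_univ]; exact J.contMDiffOn_symm
  have hI : ContMDiff 𝓘(ℝ, EM × EK) (I.prod I') ∞ (I.prod I').symm := by
    rw [← contMDiffOn_univ, ← (I.prod I').range_eq_univ]; exact (I.prod I').contMDiffOn_symm
  have hA : ContMDiff (I.prod I') J ∞ A :=
    hJ.comp (L.contDiff.contMDiff.comp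
      ((contDiff_id.sub contDiff_const).contMDiff.comp (I.prod I').contMDiff))
  have hA' : ContMDiff J (I.prod I') ∞ A.symm :=
    hI.comp ((contDiff_id.add contDiff_const).contMDiff.comp
      (L.symm.contDiff.contMDiff.comp J.contMDiff))
  refine IsImmersionAtOfComplement.mk_of_continuousAt
    (Φ.continuous.comp (by fun_prop : Continuous fun y : M => (y, c))).continuousAt L
    (chartAt HM x) e (mem_chart_source _ _) ?_ (IsManifold.chart_mem_maximalAtlas x) ?_ ?_
  · rw [hsrc, mem_preimage, Φ.symm_apply_apply]
    exact ⟨mem_chart_source _ _, mem_chart_source _ _⟩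
  · refine e.mem_maximalAtlas_of_contMDiffOn ?_ ?_
    · rw [hsrc]
      exact hA.comp_contMDiffOn ((contMDiffOn_of_mem_maximalAtlas he₀).comp
        Φ.symm.contMDiff.contMDiffOn subset_rfl)
    · rw [htgt]
      exact Φ.contMDiff.comp_contMDiffOn ((contMDiffOn_symm_of_mem_maximalAtlas he₀).comp
        hA'.contMDiffOn subset_rfl)
  -- In the adapted charts `Φ` cancels and the slice reads `z ↦ L (z, 0)`, the normal form of an
  -- immersion.
  · intro z hz
    have h1 : ((chartAt HM x).extend I) (((chartAt HM x).extend I).symm z) = z :=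
      ((chartAt HM x).extend I).right_inv hz
    change J (J.symm (L ((I.prod I') (e₀ (Φ.symm (Φ _))) - v))) = L (z, 0)
    rw [J.right_inv (by rw [J.range_eq_univ]; exact mem_univ _), Φ.symm_apply_apply]
    refine congrArg L (Prod.ext ?_ ?_)
    · exact (sub_zero _).trans h1
    · exact sub_self _

/-- A slice of a product decomposition of a manifold is an embedded submanifold. -/
theorem isSmoothEmbedding_slice (Φ : Diffeomorph (I.prod I') J (M × K) N ∞) (c : K) :
    IsSmoothEmbedding I J ∞ fun x => Φ (x, c) where
  isImmersion := isImmersion_slice Φ c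
  isEmbedding := Φ.toHomeomorph.isEmbedding.comp (isEmbedding_prodMkLeft c)

end Manifold

/-! ### From a decorated bundle to a categorical connection -/

namespace PrincipalTwoBundle.Iso

variable {G : LieTwoGroup.{u}} {X : LieGroupoid.{u}} {P : PrincipalTwoBundle G X}
  {B : PrincipalBundleOver X G.Ob} (θ : PrincipalTwoBundle.Iso (Decorated.bundle B) P)

theorem proj_ob_symm (p : P.Ob) : B.proj (θ.ob.symm p) = P.proj.ob p :=
  (θ.proj_ob _).symm.trans (congrArg P.proj.ob (θ.ob.apply_symm_apply p))

/-- An isomorphism from a decorated bundle identifies the pullbacks of the bundles of objects. -/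
def pullbackDiffeomorph :
    Diffeomorph P.pullback.I B.pullback.I P.pullback B.pullback ∞ where
  toFun x := Mfd.fiberProd.mk (Mfd.fiberProd.fst x) (θ.ob.symm (Mfd.fiberProd.snd x))
    ((Mfd.fiberProd.condition x).trans (θ.proj_ob_symm _).symm)
  invFun x := Mfd.fiberProd.mk (Mfd.fiberProd.fst x) (θ.ob (Mfd.fiberProd.snd x))
    ((Mfd.fiberProd.condition x).trans (θ.proj_ob _).symm)
  left_inv _ := Mfd.fiberProd.ext rfl (θ.ob.apply_symm_apply _)
  right_inv _ := Mfd.fiberProd.ext rfl (θ.ob.symm_apply_apply _)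
  contMDiff_toFun := Mfd.fiberProd.smooth_lift Mfd.fiberProd.smooth_fst
    (θ.ob.symm.contMDiff.comp Mfd.fiberProd.smooth_snd)
  contMDiff_invFun := Mfd.fiberProd.smooth_lift Mfd.fiberProd.smooth_fst
    (θ.ob.contMDiff.comp Mfd.fiberProd.smooth_snd)

/-- The lift `(γ, p) ↦ θ (γ, θ⁻¹ p, e)` induced by an isomorphism `θ` from a decorated bundle. -/
def lift (γ : X.Mor) (p : P.Ob) (h : X.src γ = P.proj.ob p) : P.Mor :=
  θ.mor (Decorated.mk γ (θ.ob.symm p) (h.trans (θ.proj_ob_symm p).symm) 1)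

/-- The categorical connection induced by an isomorphism from a decorated bundle. -/
def categoricalConnection : CategoricalConnection P where
  lift := θ.lift
  -- The lift is the slice at the neutral element of `H` of the diffeomorphism from `s^*E₀ × H` to
  -- the arrows of `P` obtained by identifying the pullbacks and then applying `θ`.
  isSmoothEmbedding := Manifold.isSmoothEmbedding_slice
    ((θ.pullbackDiffeomorph.prodCongr (Diffeomorph.refl G.H.I G.H ∞)).trans θ.mor) (1 : G.H)
  src_lift γ p h := (θ.src_mor _).trans (θ.ob.apply_symm_apply p)
  proj_lift γ p h := θ.proj_mor _
  lift_comp γ₂ γ₁ p₂ p₁ h₂ h₁ h hp := by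
    refine Eq.trans (congrArg θ.mor ?_) (θ.mor_comp _ _ ?_)
    -- Trivially decorated arrows are closed under composition, as decorations multiply.
    · exact Decorated.ext rfl rfl (mul_one (1 : G.H)).symm
    -- Composability upstairs: `θ` preserves targets, so the condition on `p₂` pulls back along it.
    · change θ.ob.symm p₂ = _
      rw [hp]
      exact (congrArg θ.ob.symm (θ.tgt_mor _)).trans (θ.ob.symm_apply_apply _)
  lift_one x p h := by
    refine Eq.trans (congrArg θ.mor ?_)
      ((θ.mor_one (θ.ob.symm p)).trans (congrArg P.one (θ.ob.apply_symm_apply p)))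
    exact Decorated.ext (congrArg X.one (h.symm.trans (θ.proj_ob_symm p).symm)) rfl rfl
  lift_act γ p h g := by
    refine Eq.trans (congrArg θ.mor ?_) (θ.mor_act _ _)
    refine Decorated.ext rfl ?_ (LieTwoGroup.H_ext ?_)
    · change θ.ob.symm (P.actOb p g) = B.act (θ.ob.symm p) (G.src (G.one g))
      rw [G.src_one]
      -- The inverse of an equivariant bijection is equivariant.
      exact θ.ob.toEquiv.symm_apply_eq.2 <|
        (congrArg (P.actOb · g) (θ.ob.apply_symm_apply p)).symm.trans (θ.ob_act _ g).symm
    -- A unit `1_g` acts on decorations by conjugation, which fixes the neutral element.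
    · refine Eq.trans ?_ (Decorated.incl_act _ _).symm
      change (1 : G.Mor) = (G.one g)⁻¹ * 1 * G.one (G.src (G.one g))
      rw [G.src_one]
      group

end PrincipalTwoBundle.Iso

/-! ### The Peiffer identity -/

namespace LieTwoGroup

variable (G : LieTwoGroup.{u})

/-- The Peiffer identity. -/
theorem one_τ_mul (h k : G.H) :
    G.one (G.τ h) * G.incl k = G.incl h * G.incl k * (G.incl h)⁻¹ * G.one (G.τ h) := by
  -- The element `h⁻¹ 1_{τ(h)}` has target `τ(h)⁻¹ τ(h) = 1`, while `k` has source `1`. By the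
  -- interchange law the kernels of source and target commute.
  have hc := G.commute_ker (a := G.incl k) (b := (G.incl h)⁻¹ * G.one (G.τ h)) (G.src_incl k)
    (by rw [G.tgt_mul, G.tgt_inv', G.tgt_one, G.τ_apply, inv_mul_cancel])
  rw [mul_assoc (G.incl h * G.incl k), mul_assoc (G.incl h), hc]
  group

end LieTwoGroup

/-! ### From a categorical connection to a decorated bundle -/

namespace CategoricalConnection

variable {G : LieTwoGroup.{u}} {X : LieGroupoid.{u}} {P : PrincipalTwoBundle G X}
  (C : CategoricalConnection P)

/-- The incidence condition inside a lift depends on both `γ` and `p`, so replacing them by equal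
ones needs this transport. -/
theorem lift_congr {γ γ' : X.Mor} {p p' : P.Ob} (hγ : γ = γ') (hp : p = p')
    (h : X.src γ = P.proj.ob p) : C.lift γ p h = C.lift γ' p' (hγ ▸ hp ▸ h) := by
  subst hγ hp; rfl

/-- The map `θ ((γ, p), h) = C(γ, p) h⁻¹` from the arrows of the decorated bundle. -/
def decMor (e : Decorated.Mor C.bundleOver) : P.Mor :=
  P.actMor (C.lift (Decorated.arrow e) (Decorated.src e) (Decorated.src_arrow e)) (G.incl e.2⁻¹)

theorem src_decMor (e : Decorated.Mor C.bundleOver) :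
    P.src (C.decMor e) = Decorated.src e :=
  (P.src_act _ _).trans <| (congrArg₂ P.actOb (C.src_lift _ _ _) (G.src_incl _)).trans <|
    P.principalOb.act_one _

/-- The target of a decorated arrow, `μ(γ, p) τ(h⁻¹)` with `μ = t ∘ C`, is exactly what equivariance
of the target map of `P` produces. -/
theorem tgt_decMor (e : Decorated.Mor C.bundleOver) :
    P.tgt (C.decMor e) = Decorated.tgt e :=
  P.tgt_act _ _

theorem proj_decMor (e : Decorated.Mor C.bundleOver) :
    P.proj.mor (C.decMor e) = Decorated.arrow e :=
  (P.principalMor.proj_act _ _).trans (C.proj_lift _ _ _)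

theorem smooth_decMor : Mfd.Smooth C.decMor :=
  P.principalMor.smooth_act.comp ((C.isSmoothEmbedding.contMDiff.comp contMDiff_fst).prodMk
    (G.smooth_incl.comp contMDiff_snd.inv))

/-- The horizontal arrow with the same source and the same projection as a given arrow. -/
def horizontal (e : P.Mor) : P.Mor := C.lift (P.proj.mor e) (P.src e) (P.proj.src_mor e)

theorem smooth_horizontal : Mfd.Smooth C.horizontal :=
  C.isSmoothEmbedding.contMDiff.comp (Mfd.fiberProd.smooth_lift
    (h := fun e => Mfd.fiberProd.mk (P.proj.mor e) (P.src e) (P.proj.src_mor e))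
    P.proj.smooth_mor P.src_sub.smooth)

/-- Both arrows project to the same arrow of `X`, and `G₁` is transitive on the fibres. -/
theorem exists_actMor_horizontal (e : P.Mor) : ∃ k, P.actMor (C.horizontal e) k = e :=
  P.principalMor.exists_act_eq (C.proj_lift _ _ _)

/-- The vertical part of an arrow: the element `k ∈ G₁` with `e = C(π(e), s(e)) k`. -/
def vertical (e : P.Mor) : G.Mor := (C.exists_actMor_horizontal e).choose

theorem actMor_vertical (e : P.Mor) : P.actMor (C.horizontal e) (C.vertical e) = e :=
  (C.exists_actMor_horizontal e).choose_spec

/-- Although obtained by choice, the vertical part solves an equation between smoothly varying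
points of a principal bundle, and such solutions are smooth. -/
theorem smooth_vertical : Mfd.Smooth C.vertical :=
  P.principalMor.contMDiff_of_act C.smooth_horizontal contMDiff_id C.actMor_vertical

/-- An arrow and its horizontal companion have the same source, so the source of the vertical part
fixes a point of `P.Ob`, where `G₀` acts freely. This is what places the vertical part in `H`. -/
theorem src_vertical (e : P.Mor) : G.src (C.vertical e) = 1 := by
  refine P.principalOb.act_injective (P.src e) ?_
  have h := congrArg P.src (C.actMor_vertical e)
  rw [P.src_act, horizontal, C.src_lift] at h
  exact h.trans (P.principalOb.act_one _).symm

/-- The diffeomorphism `θ ((γ, p), h) = C(γ, p) h⁻¹` from the arrows of the decorated bundle. -/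
def decMorDiffeomorph :
    Diffeomorph (Decorated.Mor C.bundleOver).I P.Mor.I (Decorated.Mor C.bundleOver) P.Mor ∞ where
  toFun := C.decMor
  invFun e := Decorated.mk (B := C.bundleOver) (P.proj.mor e) (P.src e) (P.proj.src_mor e)
    -- The inverse compensates for the `h⁻¹` in the definition of `θ`.
    (G.toH (C.vertical e) (C.src_vertical e))⁻¹
  left_inv e := by
    refine Decorated.ext (C.proj_decMor e) (C.src_decMor e) (LieTwoGroup.H_ext ?_)
    change (C.vertical (C.decMor e))⁻¹ = G.incl e.2
    rw [inv_eq_iff_eq_inv, ← G.incl_inv]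
    -- Both the vertical part and `h⁻¹` carry the horizontal arrow to `θ((γ, p), h)`, so they agree
    -- by freeness.
    refine P.principalMor.act_injective (C.horizontal (C.decMor e)) ?_
    refine (C.actMor_vertical _).trans (congrArg (P.actMor · (G.incl e.2⁻¹)) ?_)
    exact C.lift_congr (C.proj_decMor e).symm (C.src_decMor e).symm _
  right_inv e := by
    refine Eq.trans (congrArg (P.actMor (C.horizontal e)) ?_) (C.actMor_vertical e)
    exact inv_inv (C.vertical e)
  contMDiff_toFun := C.smooth_decMor
  contMDiff_invFun := Decorated.contMDiff_lift P.proj.smooth_mor P.src_sub.smooth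
    (LieTwoGroup.contMDiff_H C.smooth_vertical).inv

theorem decMor_one (p : P.Ob) : C.decMor (Decorated.one (B := C.bundleOver) p) = P.one p := by
  change P.actMor (C.lift (X.one (P.proj.ob p)) p _) (1 : G.Mor)⁻¹ = P.one p
  rw [C.lift_one _ p rfl, inv_one, P.principalMor.act_one]

/-- With `g = src k`, the lift contributes `1_g` and the new decoration is `k⁻¹ h 1_g`. Its inverse
is `1_g⁻¹ h⁻¹ k`, so the units cancel and `h⁻¹ k` remains. -/
theorem decMor_act (e : Decorated.Mor C.bundleOver) (k : G.Mor) :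
    C.decMor (Decorated.act e k) = P.actMor (C.decMor e) k := by
  change P.actMor (C.lift (Decorated.arrow e) (P.actOb (Decorated.src e) (G.src k)) _)
    (G.incl (Decorated.act e k).2)⁻¹ = P.actMor (P.actMor _ (G.incl e.2)⁻¹) k
  rw [C.lift_act _ _ (Decorated.src_arrow e), ← P.principalMor.act_mul,
    ← P.principalMor.act_mul, Decorated.incl_act]
  congr 1
  group

/-- Write `a = h₁⁻¹`, `b = h₂⁻¹`. The two images are `c₂ (1_{τ(a)} b)` and `c₁ a` for composable
lifts `c₂`, `c₁`. By interchange their composite is `(c₂ ∘ c₁)` acted on by `(1_{τ(a)} b) ∘ a`, and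
the Peiffer identity makes the latter `a b = (h₂ h₁)⁻¹`. -/
theorem decMor_comp (e₂ e₁ : Decorated.Mor C.bundleOver)
    (h : Decorated.src e₂ = Decorated.tgt e₁) :
    C.decMor (Decorated.comp e₂ e₁ h) = P.comp (C.decMor e₂) (C.decMor e₁)
      ((C.src_decMor e₂).trans (h.trans (C.tgt_decMor e₁).symm)) := by
  have h0 : X.src (Decorated.arrow e₂) = X.tgt (Decorated.arrow e₁) :=
    (Decorated.src_arrow e₂).trans
      ((congrArg P.proj.ob h).trans (Decorated.proj_tgt e₁))
  let c₁ := C.lift (Decorated.arrow e₁) (Decorated.src e₁) (Decorated.src_arrow e₁)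
  have h1 : X.src (Decorated.arrow e₂) = P.proj.ob (P.tgt c₁) :=
    h0.trans (C.proj_tgt_lift _ _ _).symm
  -- The lift starts at the end of `c₁` and not at the source of `e₂`, which differs from it by
  -- `τ(h₁⁻¹)`; only then does functoriality of `C` apply to `c₂` and `c₁`.
  let c₂ := C.lift (Decorated.arrow e₂) (P.tgt c₁) h1
  have hc : P.src c₂ = P.tgt c₁ := C.src_lift _ _ _
  have hk : G.src (G.one (G.τ e₁.2⁻¹) * G.incl e₂.2⁻¹) = G.tgt (G.incl e₁.2⁻¹) := by
    rw [G.src_mul, G.src_one, G.src_incl, mul_one, G.τ_apply]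
  -- Equivariance of `C` converts the shift of the starting point into the unit `1_{τ(h₁⁻¹)}`.
  have h2 : C.decMor e₂ = P.actMor c₂ (G.one (G.τ e₁.2⁻¹) * G.incl e₂.2⁻¹) := by
    rw [P.principalMor.act_mul, ← C.lift_act _ _ h1]
    exact congrArg (P.actMor · (G.incl e₂.2⁻¹)) (C.lift_congr rfl h _)
  have h3 : C.decMor (Decorated.comp e₂ e₁ h) =
      P.actMor (P.comp c₂ c₁ hc) (G.incl (e₂.2 * e₁.2)⁻¹) :=
    congrArg (P.actMor · (G.incl (e₂.2 * e₁.2)⁻¹))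
      (C.lift_comp _ _ _ _ h1 (Decorated.src_arrow e₁) h0 rfl)
  rw [h3, LieGroupoid.comp_congr h2 rfl]
  refine Eq.trans (congrArg (P.actMor _) ?_) (P.comp_act c₂ c₁ _ _ hc hk).symm
  -- Composition in `G₁` is `k₂ 1_{src k₂}⁻¹ k₁`, here `1_{τ(a)} b 1_{τ(a)}⁻¹ a`. The Peiffer
  -- identity rewrites it as `a b a⁻¹ a = a b`.
  rw [G.comp_eq, G.src_mul, G.src_one, G.src_incl, mul_one, G.one_τ_mul, mul_inv_cancel_right,
    inv_mul_cancel_right, ← G.incl_mul, mul_inv_rev]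

/-- The isomorphism with the decorated bundle defined by a categorical connection. -/
def decoratedIso : PrincipalTwoBundle.Iso (Decorated.bundle C.bundleOver) P where
  ob := Diffeomorph.refl P.Ob.I P.Ob ∞
  mor := C.decMorDiffeomorph
  src_mor := C.src_decMor
  tgt_mor := C.tgt_decMor
  mor_one := C.decMor_one
  mor_comp := C.decMor_comp
  proj_ob _ := rfl
  proj_mor := C.proj_decMor
  ob_act _ _ := rfl
  mor_act := C.decMor_act

end CategoricalConnection

end

theorem mainTheorem4 (G : LieTwoGroup.{u}) (X : LieGroupoid.{u}) (P : PrincipalTwoBundle G X) :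
    ((∃ B : PrincipalBundleOver X G.Ob,
        Nonempty (PrincipalTwoBundle.Iso (Decorated.bundle B) P)) ↔
      Nonempty (CategoricalConnection P)) ∧
    ∀ C : CategoricalConnection P,
      ∃ θ : PrincipalTwoBundle.Iso (Decorated.bundle C.bundleOver) P,
        (∀ p : P.Ob, θ.ob p = p) ∧
        ∀ (γ : X.Mor) (p : P.Ob) (hγ : X.src γ = P.proj.ob p) (h : G.H),
          θ.mor (Decorated.mk γ p hγ h) = P.actMor (C.lift γ p hγ) (G.incl h⁻¹) :=
  -- The isomorphism of part (b) also gives the "if" direction of part (a), and its formula on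
  -- arrows holds by definition.
  ⟨⟨fun ⟨_, ⟨θ⟩⟩ => ⟨θ.categoricalConnection⟩, fun ⟨C⟩ => ⟨C.bundleOver, ⟨C.decoratedIso⟩⟩⟩,
    fun C => ⟨C.decoratedIso, fun _ => rfl, fun _ _ _ _ => rfl⟩⟩
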